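/- **Setting.** Let $(\Omega,\mathcal A,\mathbb P)$ be a probability space with a measurable, $\mathbb P$-preserving flow $(\theta_v)_{v\in\mathbb R^2}$. Let $\Phi$ (transmitters) and $\Psi$ (receivers) be simple, locally finite point processes on $\mathbb R^2$ that are compatible with the flow (hence jointly stationary) and jointly ergodic, where the intensity $\lambda_\Psi=\mathbb E[\Psi([0,1)^2)]$ of $\Psi$ satisfies $0<\lambda_\Psi<\infty$. Let $\mathbb P_\Psi^o(A)=\lambda_\Psi^{-1}\,\mathbb E\sum_{y\in\Psi\cap[0,1)^2}\mathbf 1_A(\theta_y\omega)$ be the Palm probability of $\Psi$. Each transmitter has its own dedicated receiver at a fixed distance $\tau>0$, in an arbitrary, possibly random (for instance uniformly random) direction; this pairing is a flow-compatible bijection between $\Phi$ and $\Psi$. Under $\mathbb P_\Psi^o$ there is a receiver at the origin $o$; let $t\in\Phi$, $\|t\|=\tau$, be its transmitter. Let the path loss $\ell:[0,\infty)\to[0,\infty)$ be continuous and non-increasing with $\ell(0)=1$, $\ell(\tau)>0$ and $\int_0^\infty r\,\ell(r)\,\mathrm dr<\infty$, and let $W\ge 0$ be the noise power. Under $\mathbb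 P_\Psi^o$, let the fading variables $\{h_x\}_{x\in\Phi}$ (from $x$ to $o$) be i.i.d., independent of $(\Phi,t)$, non-negative, with unit mean and with a probability density $f_h$, and let them satisfy the exponential moment condition: there is $s^*>0$ such that $\mathbb E[e^{sh}]<\infty$ for all $s\in[0,s^*)$. Write $\mathcal L_h(s)=\mathbb E[e^{-sh}]$. Put $$\mathrm{SINR}=\frac{h_t\,\ell(\tau)}{\sum_{x\in\Phi\setminus\{t\}}h_x\,\ell(\|x\|)+W},\qquad P_{\mathrm s}(\theta)=\mathbb P_\Psi^o(\mathrm{SINR}>\theta\mid\Phi)$$ (the SINR being $+\infty$ when its numerator is positive and its denominator is $0$). Let $\sigma,\nu\ge0$ and $\rho\in\mathbb R$, and suppose that $\Phi$ is $(\sigma,\rho,\nu)$-ball regulated with respect to $\Psi$: for every $r\ge0$, $\Phi(b(o,r))\le\sigma+\rho r+\nu r^2$, $\mathbb P_\Psi^o$-a.s., where $b(o,r)$ is the open ball of radius $r$ centred at $o$. For a function $L$ on $[0,\infty)$ let $$A_L=\sigma L(0)+\rho\int_0^\infty L(r)\,\mathrm dr+2\nu\int_0^\infty r\,L(r)\,\mathrm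 dr,$$ and for $s\in[0,s^*)$ let $\tilde\ell(r)=\tilde\ell_s(r)=\log\mathcal L_h(-s\,\ell(r))$. **Theorem (Reliability lower bound for all links).** For every $s^*>0$ as in the exponential moment condition and every $\theta>0$, the function $$\zeta(\theta)=\int_{W\theta/\ell(\tau)}^\infty f_h(x)\Bigl(1-\exp\Bigl(\inf_{s\in[0,s^*)}\bigl[A_{\tilde\ell}-\tilde\ell(\tau)-s\bigl(x\,\ell(\tau)\,\theta^{-1}-W\bigr)\bigr]\Bigr)\Bigr)^+\mathrm dx$$ is well defined (the integrals in $A_{\tilde\ell}$ converge, the infimum is finite, and the integrand is integrable), and $$P_{\mathrm s}(\theta)\ge\zeta(\theta),\qquad\mathbb P_\Psi^o\text{-a.s.}$$ Moreover, for every $\epsilon>0$ there is $\delta>0$ such that for every $\theta\in(0,\delta]$ all links achieve reliability $1-\epsilon$, namely $P_{\mathrm s}(\theta)>1-\epsilon$, $\mathbb P_\Psi^o$-a.s. -/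

import Mathlib

open MeasureTheory ProbabilityTheory Set
open scoped ENNReal

noncomputable section

namespace SpatialCalculus

/-- The Euclidean plane `ℝ²`. -/
abbrev Plane : Type := EuclideanSpace ℝ (Fin 2)

/-! ### Point processes in a stationary framework

A stationary framework is a probability space `(Ω, P)` on which the plane acts by a jointly
measurable, `P`-preserving flow `ω ↦ v +ᵥ ω`.  Point processes that are compatible with the flow
are jointly stationary. -/

/-- The counting measure `L ↦ #(S ∩ L)` of a set of points `S`. -/
def pointMeasure (S : Set Plane) : Measure Plane := Measure.count.restrict S

/-- `Φ` is a (simple) point process: a random set of points which is locally finite and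
whose counting measure is a random measure. -/
structure IsPointProcess {Ω : Type*} [MeasurableSpace Ω] (Φ : Ω → Set Plane) : Prop where
  locallyFinite : ∀ ω r, (Φ ω ∩ Metric.ball 0 r).Finite
  measurable : Measurable fun ω => pointMeasure (Φ ω)

/-- `Φ` is compatible with the flow: the configuration at `v +ᵥ ω` is the configuration at `ω`
seen from `v`, that is, translated by `-v`. -/
def IsFlowCompatible {Ω : Type*} [AddAction Plane Ω] (Φ : Ω → Set Plane) : Prop :=
  ∀ (v : Plane) (ω : Ω) (x : Plane), x ∈ Φ (v +ᵥ ω) ↔ x + v ∈ Φ ω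

/-- The `σ`-algebra generated by a point process. -/
abbrev sigmaOf {Ω : Type*} (Φ : Ω → Set Plane) : MeasurableSpace Ω :=
  MeasurableSpace.comap (fun ω => pointMeasure (Φ ω)) inferInstance

/-- Joint ergodicity of two point processes compatible with the flow: every flow-invariant event
expressed through them has probability `0` or `1`. -/
def IsJointlyErgodic {Ω : Type*} [MeasurableSpace Ω] [AddAction Plane Ω] (P : Measure Ω)
    (Φ Ψ : Ω → Set Plane) : Prop :=
  ∀ A : Set Ω, MeasurableSet[sigmaOf Φ ⊔ sigmaOf Ψ] A →
    (∀ v : Plane, (fun ω => v +ᵥ ω) ⁻¹' A = A) → P A = 0 ∨ P A = 1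

/-- The unit square `[0,1)²`. -/
def unitSquare : Set Plane := {x | ∀ i, x i ∈ Set.Ico (0 : ℝ) 1}

/-- The intensity of a point process: the mean number of points in the unit square. -/
def intensity {Ω : Type*} [MeasurableSpace Ω] (P : Measure Ω) (Ψ : Ω → Set Plane) : ℝ≥0∞ :=
  ∫⁻ ω, pointMeasure (Ψ ω) unitSquare ∂P

/-- The Palm probability of `Ψ`:
`A ↦ (1 / λ) * 𝔼 [∑_{y ∈ Ψ ∩ [0,1)²} 1_A (y +ᵥ ω)]`, with `λ` the intensity of `Ψ`. -/
def palm {Ω : Type*} [MeasurableSpace Ω] [AddAction Plane Ω] (P : Measure Ω)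
    (Ψ : Ω → Set Plane) : Measure Ω :=
  (intensity P Ψ)⁻¹ •
    P.bind fun ω => ((pointMeasure (Ψ ω)).restrict unitSquare).map fun y => y +ᵥ ω

/-! The following facts show that `palm` is given by its defining formula. -/

lemma finite_unitSquare {Ω : Type*} [MeasurableSpace Ω] {Ψ : Ω → Set Plane}
    (hΨ : IsPointProcess Ψ) (ω : Ω) : pointMeasure (Ψ ω) unitSquare < ∞ := by
  have hsub : unitSquare ⊆ Metric.ball (0:Plane) 2 := by
    intro x hx
    have h0 := hx 0
    have h1 := hx 1
    simp only [Set.mem_Ico] at h0 h1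
    rw [mem_ball_zero_iff, EuclideanSpace.norm_eq, Real.sqrt_lt' (by norm_num)]
    simp only [Fin.sum_univ_two, Real.norm_eq_abs, sq_abs]
    nlinarith
  refine (measure_mono hsub).trans_lt ?_
  rw [pointMeasure, Measure.restrict_apply Metric.isOpen_ball.measurableSet, Set.inter_comm]
  exact Measure.count_apply_lt_top.2 (hΨ.locallyFinite ω 2)

lemma measurableSet_unitSquare : MeasurableSet unitSquare := by
  unfold unitSquare
  simp only [Set.ofPred_forall]
  refine MeasurableSet.iInter fun i => ?_
  have : Measurable fun x : Plane => x i := by fun_prop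
  exact this measurableSet_Ico

lemma measurable_palmKernel {Ω : Type*} [MeasurableSpace Ω] [AddAction Plane Ω]
    [MeasurableVAdd₂ Plane Ω] {Ψ : Ω → Set Plane} (hΨ : IsPointProcess Ψ) :
    Measurable fun ω => ((pointMeasure (Ψ ω)).restrict unitSquare).map
      (fun y : Plane => y +ᵥ ω) := by
  classical
  refine Measure.measurable_of_measurable_coe _ fun A hA => ?_
  have hmeas : Measurable fun p : Ω × Plane => p.2 +ᵥ p.1 := by fun_prop
  let κ : Kernel Ω Plane := ⟨fun ω => (pointMeasure (Ψ ω)).restrict unitSquare,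
    by
      refine Measure.measurable_of_measurable_coe _ fun B hB => ?_
      simp only [Measure.restrict_apply hB]
      exact (Measure.measurable_coe (hB.inter measurableSet_unitSquare)).comp hΨ.measurable⟩
  have hfin : ∀ ω, κ ω univ < ∞ := fun ω => by
    change ((pointMeasure (Ψ ω)).restrict unitSquare) univ < ∞
    rw [Measure.restrict_apply_univ]; exact finite_unitSquare hΨ ω
  let S : ℕ → Set Ω := fun n => {ω | κ ω univ ≤ n}
  have hS : ∀ n, MeasurableSet (S n) := fun n =>
    measurableSet_le (κ.measurable_coe MeasurableSet.univ) measurable_const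
  let κn : ℕ → Kernel Ω Plane := fun n => Kernel.piecewise (hS n) κ 0
  have hκn : ∀ n, IsFiniteKernel (κn n) := fun n => ⟨⟨n, by simp, fun ω => by
    by_cases hω : ω ∈ S n
    · rw [Kernel.piecewise_apply, if_pos hω]; exact hω
    · rw [Kernel.piecewise_apply, if_neg hω]; simp⟩⟩
  have hT : MeasurableSet ((fun p : Ω × Plane => p.2 +ᵥ p.1) ⁻¹' A) := hmeas hA
  have key : ∀ n, Measurable fun ω => κn n ω (Prod.mk ω ⁻¹'
      ((fun p : Ω × Plane => p.2 +ᵥ p.1) ⁻¹' A)) := fun n =>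
    Kernel.measurable_kernel_prodMk_left hT
  convert Measurable.iSup key using 2 with ω
  have hAω : Measurable fun y : Plane => y +ᵥ ω := by fun_prop
  rw [Measure.map_apply hAω hA]
  refine le_antisymm ?_ (iSup_le fun n => ?_)
  · obtain ⟨n, hn⟩ := ENNReal.exists_nat_gt (hfin ω).ne
    refine le_iSup_of_le n ?_
    have : ω ∈ S n := hn.le
    simp only [κn, Kernel.piecewise_apply, if_pos this]
    exact le_rfl
  · by_cases hω : ω ∈ S n
    · simp only [κn, Kernel.piecewise_apply, if_pos hω]
      exact le_rfl
    · simp only [κn, Kernel.piecewise_apply, if_neg hω]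
      simp

/-- The defining formula of the Palm probability. -/
theorem palm_apply {Ω : Type*} [MeasurableSpace Ω] [AddAction Plane Ω]
    [MeasurableVAdd₂ Plane Ω] (P : Measure Ω) {Ψ : Ω → Set Plane} (hΨ : IsPointProcess Ψ)
    {A : Set Ω} (hA : MeasurableSet A) :
    palm P Ψ A = (intensity P Ψ)⁻¹ *
      ∫⁻ ω, pointMeasure (Ψ ω) ({y | y +ᵥ ω ∈ A} ∩ unitSquare) ∂P := by
  rw [palm, Measure.smul_apply, smul_eq_mul,
    Measure.bind_apply hA (measurable_palmKernel hΨ).aemeasurable]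
  congr 1
  refine lintegral_congr fun ω => ?_
  have hAω : Measurable fun y : Plane => y +ᵥ ω := by fun_prop
  rw [Measure.map_apply hAω hA, Measure.restrict_apply (hAω hA)]
  rfl

/-- `Φ` is (weakly) `(σ, ρ, ν)`-ball regulated under `Q`, which is the Palm probability of the
observer process: for each `r ≥ 0`, the number of points of `Φ` in the open ball `b(o, r)` is
`Q`-almost surely at most `σ + ρ r + ν r²`. -/
def IsBallRegulated {Ω : Type*} [MeasurableSpace Ω] (Q : Measure Ω) (Φ : Ω → Set Plane)
    (σ ρ ν : ℝ) : Prop :=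
  ∀ r : ℝ, 0 ≤ r → ∀ᵐ ω ∂Q,
    ((Φ ω ∩ Metric.ball 0 r).ncard : ℝ) ≤ σ + ρ * r + ν * r ^ 2

/-! ### The bipolar network -/

/-- Bipolar network with link distance `τ`: every transmitter (point of `Φ`) has its own receiver
(point of `Ψ`) at distance `τ`.  Here `tx ω y` is the dedicated transmitter of the receiver `y`,
and the pairing is compatible with the flow. -/
structure IsBipolarNetwork {Ω : Type*} [MeasurableSpace Ω] [AddAction Plane Ω]
    (Φ Ψ : Ω → Set Plane) (tx : Ω → Plane → Plane) (τ : ℝ) : Prop where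
  bijOn : ∀ ω, Set.BijOn (tx ω) (Ψ ω) (Φ ω)
  dist_eq : ∀ ω, ∀ y ∈ Ψ ω, dist (tx ω y) y = τ
  compatible : ∀ (v : Plane) (ω : Ω), ∀ y ∈ Ψ (v +ᵥ ω), tx (v +ᵥ ω) y = tx ω (y + v) - v
  measurable : Measurable fun ω => tx ω 0

/-- The marks `(h ω x)_{x ∈ Φ ω}` are, under `Q`, i.i.d. with law `η` and independent of the
`σ`-algebra `𝒢` (which carries the locations): for an enumeration `X` of the points of `Φ` which
is a function of the locations, the sequence of marks `h ω (X n ω)` is i.i.d. with law `η` and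
independent of `𝒢`. -/
def IsIIDMarking {Ω : Type*} (𝒢 : MeasurableSpace Ω) [MeasurableSpace Ω] (Q : Measure Ω)
    (Φ : Ω → Set Plane) (h : Ω → Plane → ℝ) (η : Measure ℝ) : Prop :=
  ∃ X : ℕ → Ω → Plane,
    (∀ n, Measurable[𝒢] (X n)) ∧
    (∀ᵐ ω ∂Q, Function.Injective (fun n => X n ω) ∧ Set.range (fun n => X n ω) = Φ ω) ∧
    (∀ n, Measurable fun ω => h ω (X n ω)) ∧
    (∀ n, Q.map (fun ω => h ω (X n ω)) = η) ∧
    iIndepFun (fun n ω => h ω (X n ω)) Q ∧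
    Indep (MeasurableSpace.comap (fun ω n => h ω (X n ω)) MeasurableSpace.pi) 𝒢 Q

/-- Path loss functions `ℓ : [0, ∞) → [0, ∞)` (values at negative arguments are irrelevant). -/
structure IsPathLoss (ℓ : ℝ → ℝ) : Prop where
  nonneg : ∀ r, 0 ≤ r → 0 ≤ ℓ r
  antitone : AntitoneOn ℓ (Set.Ici 0)
  continuous : ContinuousOn ℓ (Set.Ici 0)
  at_zero : ℓ 0 = 1
  integrable : IntegrableOn (fun r => r * ℓ r) (Set.Ioi 0)

/-- A non-negative random variable with law `η` has finite moment-generating function on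
`[0, sStar)`. -/
def FiniteMgfOn (η : Measure ℝ) (sStar : ℝ) : Prop :=
  ∀ s ∈ Set.Ico 0 sStar, Integrable (fun u => Real.exp (s * u)) η

/-- Exponential moment (Cramér) condition for the law `η`. -/
def HasExponentialMoments (η : Measure ℝ) : Prop := ∃ sStar : ℝ, 0 < sStar ∧ FiniteMgfOn η sStar

/-- The interference `∑_{x ∈ S \ {t}} g x * ℓ ‖x‖` at the origin. -/
def interference (ℓ : ℝ → ℝ) (S : Set Plane) (t : Plane) (g : Plane → ℝ) : ℝ≥0∞ :=
  ∑' x : ↥(S \ {t}), ENNReal.ofReal (g x * ℓ ‖(x : Plane)‖)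

/-- The SINR at the origin, in `[0, ∞]` (so that it is `∞` when a positive signal meets neither
noise nor interference), of the link from the transmitter `t` at distance `τ`, for the transmitter
configuration `S` and fading `g`. -/
def sinr (ℓ : ℝ → ℝ) (τ W : ℝ) (S : Set Plane) (t : Plane) (g : Plane → ℝ) : ℝ≥0∞ :=
  ENNReal.ofReal (g t * ℓ τ) / (interference ℓ S t g + ENNReal.ofReal W)

/-- The link reliability `P_s(θ) = Q (SINR > θ ∣ Φ)` of the typical link, whose receiver is at the
origin and whose transmitter is `tx ω 0`; `Q` is the Palm probability of the receivers. -/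
def linkReliability {Ω : Type*} [MeasurableSpace Ω] (Q : Measure Ω) (Φ : Ω → Set Plane)
    (tx : Ω → Plane → Plane) (h : Ω → Plane → ℝ) (ℓ : ℝ → ℝ) (τ W θ : ℝ) : Ω → ℝ :=
  Q⟦{ω | ENNReal.ofReal θ < sinr ℓ τ W (Φ ω) (tx ω 0) (h ω)} | sigmaOf Φ⟧

/-! ### The lower bound -/

/-- Laplace transform `𝓛(s) = 𝔼 [exp (-s h)]` of a random variable `h` with law `η`. -/
def laplace (η : Measure ℝ) (s : ℝ) : ℝ := ∫ u, Real.exp (-s * u) ∂η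

/-- `ℓ̃(r) = log 𝓛_h(-s ℓ(r))`. -/
def tildeLoss (η : Measure ℝ) (ℓ : ℝ → ℝ) (s r : ℝ) : ℝ := Real.log (laplace η (-(s * ℓ r)))

/-- `A_L = σ L(0) + ρ ∫₀^∞ L(r) dr + 2 ν ∫₀^∞ r L(r) dr`. -/
def shotNoiseBound (σ ρ ν : ℝ) (L : ℝ → ℝ) : ℝ :=
  σ * L 0 + ρ * (∫ r in Set.Ioi 0, L r) + 2 * ν * ∫ r in Set.Ioi 0, r * L r

/-- The Chernoff exponent `A_{ℓ̃} - ℓ̃(τ) - s (x ℓ(τ) / θ - W)`. -/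
def chernoffExponent (η : Measure ℝ) (ℓ : ℝ → ℝ) (τ W σ ρ ν θ x s : ℝ) : ℝ :=
  shotNoiseBound σ ρ ν (tildeLoss η ℓ s) - tildeLoss η ℓ s τ - s * (x * ℓ τ / θ - W)

/-- The integrand of `ζ(θ)`; `f` is the density of the fading. -/
def zetaIntegrand (f : ℝ → ℝ) (η : Measure ℝ) (ℓ : ℝ → ℝ) (τ W σ ρ ν sStar θ x : ℝ) : ℝ :=
  f x * max 0
    (1 - Real.exp (⨅ s : Set.Ico (0 : ℝ) sStar, chernoffExponent η ℓ τ W σ ρ ν θ x s))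

/-- The deterministic lower bound `ζ(θ)`. -/
def zeta (f : ℝ → ℝ) (η : Measure ℝ) (ℓ : ℝ → ℝ) (τ W σ ρ ν sStar θ : ℝ) : ℝ :=
  ∫ x in Set.Ioi (W * θ / ℓ τ), zetaIntegrand f η ℓ τ W σ ρ ν sStar θ x

/-- All the integrals and the infimum in `ζ(θ)` are genuine: the two integrals in `A_{ℓ̃}`
converge, the infimum is finite, and the integrand of `ζ(θ)` is integrable. -/
structure ZetaWellDefined (f : ℝ → ℝ) (η : Measure ℝ) (ℓ : ℝ → ℝ)
    (τ W σ ρ ν sStar θ : ℝ) : Prop where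
  integrable_tilde : ∀ s ∈ Set.Ico 0 sStar, IntegrableOn (tildeLoss η ℓ s) (Set.Ioi 0)
  integrable_mul_tilde :
    ∀ s ∈ Set.Ico 0 sStar, IntegrableOn (fun r => r * tildeLoss η ℓ s r) (Set.Ioi 0)
  bddBelow : ∀ x ∈ Set.Ioi (W * θ / ℓ τ),
    BddBelow (chernoffExponent η ℓ τ W σ ρ ν θ x '' Set.Ico 0 sStar)
  integrable :
    IntegrableOn (zetaIntegrand f η ℓ τ W σ ρ ν sStar θ) (Set.Ioi (W * θ / ℓ τ))

end SpatialCalculus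

end

/-!
Fix a realization of the transmitters that is regulated by balls, with the dedicated transmitter `t`
of the receiver at the origin at distance `τ`.

The exponent of Chernoff's bound comes from a deterministic estimate.  If `L` is non-negative,
continuous and non-increasing, its superlevel sets `{u < L}` are intervals `[0, R u)`, so by the layer
cake formula `∑ x ∈ Φ, L ‖x‖ = ∫ u, Φ(b(o, R u))`, which is at most
`∫ u in 0..L 0, (σ + ρ R u + ν (R u)²)`.  Applying the layer cake formula backwards, for the measures
`dr` and `2 r dr` on `(0, ∞)`, identifies this integral with `A_L` (`sum_le_shotNoiseBound`); no sign
of `ρ` is needed.  It applies to `L = ℓ̃_s`, the logarithmic moment-generating function of the fading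
at `s ℓ`, which is dominated by a multiple of `ℓ` by convexity (`tildeLoss_le`).

For independent fading, `log 𝔼 exp (s I) = ∑ x ∈ Φ \ {t}, ℓ̃_s ‖x‖ ≤ A_{ℓ̃_s} - ℓ̃_s(τ)` for the
interference `I`, so Chernoff's inequality bounds `ℙ(I ≥ x ℓ(τ) / θ - W)` for each value `x` of the
fading from `t`, which is independent of `I` and has density `f`.  Integrating over `x` gives `ζ(θ)`
(`ofReal_zeta_le_measure`).  As the fading is independent of the locations, a bound valid for almost
every configuration is a bound for the conditional probability (`le_condExp_of_indep`).

The same shot-noise estimate shows that `A_{ℓ̃_s} - ℓ̃_s(τ) ≥ 0`, which makes the infimum in `ζ(θ)`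
finite.  Finally `ζ(θ) → 1` as `θ → 0`, since a single exponent `s > 0` suffices once the fading
exceeds a fixed positive level (`exists_forall_lt_zeta`).
-/

namespace SpatialCalculus

/-! ### Shot noise of a ball-regulated configuration -/

lemma exists_pos_level_iff {L : ℝ → ℝ} (hcont : ContinuousOn L (Ici 0))
    (hanti : AntitoneOn L (Ici 0)) (hint : IntegrableOn L (Ioi 0)) {u : ℝ} (hu : 0 < u)
    (huL : u < L 0) : ∃ R : ℝ, 0 < R ∧ ∀ r, 0 ≤ r → (u < L r ↔ r < R) := by
  set S : Set ℝ := Ici 0 ∩ L ⁻¹' Iic u with hS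
  have hclosed : IsClosed S := hcont.preimage_isClosed_of_isClosed isClosed_Ici isClosed_Iic
  have hne : S.Nonempty := by
    by_contra hemp
    have hall : ∀ r, 0 ≤ r → u < L r := fun r hr => by
      by_contra hlt
      exact hemp ⟨r, hr, not_lt.1 hlt⟩
    have hconst : IntegrableOn (fun _ : ℝ => u) (Ioi 0) := by
      refine Integrable.mono' hint aestronglyMeasurable_const ?_
      filter_upwards [ae_restrict_mem measurableSet_Ioi] with r hr
      rw [Real.norm_of_nonneg hu.le]
      exact (hall r (le_of_lt hr)).le
    rw [integrableOn_const_iff] at hconst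
    simp [hu.ne'] at hconst
  have hbdd : BddBelow S := ⟨0, fun r hr => hr.1⟩
  have hmem : sInf S ∈ S := hclosed.csInf_mem hne hbdd
  have hnonneg : 0 ≤ sInf S := hmem.1
  refine ⟨sInf S, lt_of_le_of_ne hnonneg ?_, fun r hr => ⟨fun h => ?_, fun h => ?_⟩⟩
  · intro h0
    have := hmem.2
    rw [← h0] at this
    exact absurd this (not_le.2 huL)
  · by_contra hle
    exact absurd h (not_lt.2 ((hanti hnonneg hr (not_lt.1 hle)).trans hmem.2))
  · by_contra hle
    exact absurd h (not_lt.2 (csInf_le hbdd ⟨hr, not_lt.1 hle⟩))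

/-- The measure `2 r dr` on `(0, ∞)`, which gives mass `R ^ 2` to `(0, R)`. -/
noncomputable def radialMeasure : Measure ℝ :=
  (volume.restrict (Ioi 0)).withDensity fun r => ENNReal.ofReal (2 * r)

lemma radialMeasure_real_of_inter_eq {A : Set ℝ} {R : ℝ} (hR : 0 ≤ R)
    (hA : A ∩ Ioi 0 = Ioo 0 R) : radialMeasure.real A = R ^ 2 := by
  have hint : IntegrableOn (fun r : ℝ => 2 * r) (Ioo 0 R) :=
    ((by fun_prop : Continuous fun r : ℝ => 2 * r).integrableOn_Icc).mono_set Ioo_subset_Icc_self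
  have hval : ∫ r in Ioo 0 R, 2 * r = R ^ 2 := by
    rw [← integral_Ioc_eq_integral_Ioo, ← intervalIntegral.integral_of_le hR,
      intervalIntegral.integral_const_mul, integral_id]
    ring
  rw [measureReal_def, radialMeasure, withDensity_apply', Measure.restrict_restrict' measurableSet_Ioi,
    hA, ← ofReal_integral_eq_lintegral_ofReal hint, hval, ENNReal.toReal_ofReal (sq_nonneg R)]
  filter_upwards [ae_restrict_mem measurableSet_Ioo] with r hr
  have := hr.1
  simp only [Pi.zero_apply]
  positivity

lemma integrable_radialMeasure {L : ℝ → ℝ} (hmul : IntegrableOn (fun r => r * L r) (Ioi 0)) :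
    Integrable L radialMeasure := by
  rw [radialMeasure, integrable_withDensity_iff_integrable_smul' (by fun_prop)
    (Filter.Eventually.of_forall fun _ => ENNReal.ofReal_lt_top)]
  refine (hmul.const_mul 2).congr ?_
  filter_upwards [ae_restrict_mem measurableSet_Ioi] with r hr
  have h0 : (0:ℝ) < r := hr
  rw [ENNReal.toReal_ofReal (by positivity), smul_eq_mul]
  ring

lemma integral_radialMeasure (L : ℝ → ℝ) :
    ∫ r, L r ∂radialMeasure = 2 * ∫ r in Ioi 0, r * L r := by
  rw [radialMeasure, integral_withDensity_eq_integral_toReal_smul (by fun_prop)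
    (Filter.Eventually.of_forall fun _ => ENNReal.ofReal_lt_top), ← integral_const_mul]
  refine setIntegral_congr_fun measurableSet_Ioi fun r hr => ?_
  have h0 : (0:ℝ) < r := hr
  simp only [smul_eq_mul]
  rw [ENNReal.toReal_ofReal (by positivity)]
  ring

lemma integrableOn_measureReal_lt {m : Measure ℝ} {L : ℝ → ℝ} (hL : Integrable L m)
    (hnn : 0 ≤ᵐ[m] L) : IntegrableOn (fun u => m.real {r | u < L r}) (Ioi 0) := by
  have hanti : Antitone fun u => m {r | u < L r} := fun u v huv =>
    measure_mono fun r (hr : v < L r) => huv.trans_lt hr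
  refine integrable_toReal_of_lintegral_ne_top hanti.measurable.aemeasurable ?_
  rw [← lintegral_eq_lintegral_meas_lt m hnn hL.aemeasurable]
  exact (hL.lintegral_lt_top).ne

/-- Layer-cake form of the shot-noise bound.  The superlevel sets `{u < L}` are intervals
`[0, R u)`, so that counting the points with `u < L ‖x‖` is counting the points of a ball. -/
lemma sum_le_shotNoiseBound {S : Set Plane} (hfin : ∀ r, (S ∩ Metric.ball 0 r).Finite)
    {σ ρ ν : ℝ}
    (hreg : ∀ r : ℝ, 0 ≤ r → ((S ∩ Metric.ball 0 r).ncard : ℝ) ≤ σ + ρ * r + ν * r ^ 2)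
    {L : ℝ → ℝ} (hcont : ContinuousOn L (Ici 0)) (hanti : AntitoneOn L (Ici 0))
    (hnn : ∀ r, 0 ≤ r → 0 ≤ L r) (hint : IntegrableOn L (Ioi 0))
    (hmul : IntegrableOn (fun r => r * L r) (Ioi 0)) (F : Finset Plane) (hF : ↑F ⊆ S) :
    ∑ x ∈ F, L ‖x‖ ≤ shotNoiseBound σ ρ ν L := by
  classical
  have hnn1 : 0 ≤ᵐ[volume.restrict (Ioi 0)] L := by
    filter_upwards [ae_restrict_mem measurableSet_Ioi] with r hr using hnn r (le_of_lt hr)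
  have hnn2 : 0 ≤ᵐ[radialMeasure] L := (withDensity_absolutelyContinuous _ _).ae_le hnn1
  have hint2 := integrable_radialMeasure hmul
  have hI1 := integrableOn_measureReal_lt hint hnn1
  have hI2 := integrableOn_measureReal_lt hint2 hnn2
  have hind : ∀ c : ℝ, IntegrableOn ((Iio c).indicator fun _ => (1:ℝ)) (Ioi 0) := fun c => by
    rw [IntegrableOn, integrable_indicator_iff measurableSet_Iio, IntegrableOn,
      Measure.restrict_restrict measurableSet_Iio, inter_comm, Ioi_inter_Iio]
    exact integrableOn_const (by simp)
  have hindval : ∀ c : ℝ, 0 ≤ c → ∫ u in Ioi 0, (Iio c).indicator (fun _ => (1:ℝ)) u = c := by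
    intro c hc
    rw [setIntegral_indicator measurableSet_Iio, Ioi_inter_Iio]
    simp [hc]
  have hsum : ∑ x ∈ F, L ‖x‖ =
      ∫ u in Ioi 0, ∑ x ∈ F, (Iio (L ‖x‖)).indicator (fun _ => (1:ℝ)) u := by
    rw [integral_finsetSum _ fun x _ => hind _]
    exact Finset.sum_congr rfl fun x _ => (hindval _ (hnn _ (norm_nonneg x))).symm
  have hbound : shotNoiseBound σ ρ ν L =
      ∫ u in Ioi 0, (σ * (Iio (L 0)).indicator (fun _ => (1:ℝ)) u
        + ρ * (volume.restrict (Ioi 0)).real {r | u < L r}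
        + ν * radialMeasure.real {r | u < L r}) := by
    have hA := (hind (L 0)).const_mul σ
    have hB := hI1.const_mul ρ
    have hC := hI2.const_mul ν
    have hAB : IntegrableOn (fun u => σ * (Iio (L 0)).indicator (fun _ => (1:ℝ)) u
        + ρ * (volume.restrict (Ioi 0)).real {r | u < L r}) (Ioi 0) := hA.add hB
    rw [integral_add hAB hC, integral_add hA hB, integral_const_mul, integral_const_mul,
      integral_const_mul, hindval _ (hnn 0 le_rfl), ← hint.integral_eq_integral_meas_lt hnn1,
      ← hint2.integral_eq_integral_meas_lt hnn2, integral_radialMeasure, shotNoiseBound]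
    ring
  rw [hsum, hbound]
  refine setIntegral_mono_on (integrable_finsetSum _ fun x _ => hind _)
    ((((hind (L 0)).const_mul σ).add (hI1.const_mul ρ)).add (hI2.const_mul ν))
    measurableSet_Ioi fun u hu => ?_
  rcases le_or_gt (L 0) u with h0 | h0
  · have hempty : {r | u < L r} ∩ Ioi 0 = Ioo 0 0 := by
      rw [Ioo_self]
      refine eq_empty_of_forall_notMem fun r hr => ?_
      exact absurd hr.1 (not_lt.2 ((hanti self_mem_Ici (mem_Ici.2 (le_of_lt hr.2))
        (le_of_lt hr.2)).trans h0))
    rw [radialMeasure_real_of_inter_eq le_rfl hempty, measureReal_def,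
      Measure.restrict_apply' measurableSet_Ioi, hempty]
    rw [Finset.sum_eq_zero, indicator_of_notMem (by simpa using h0)]
    · simp
    · intro x _
      refine indicator_of_notMem (fun h => ?_) _
      exact absurd h (not_lt.2 ((hanti self_mem_Ici (norm_nonneg x) (norm_nonneg x)).trans h0))
  · obtain ⟨R, hR, hlev⟩ := exists_pos_level_iff hcont hanti hint hu h0
    have hlevel : {r | u < L r} ∩ Ioi 0 = Ioo 0 R := by
      ext r
      constructor
      · exact fun hr => ⟨hr.2, (hlev r (le_of_lt hr.2)).1 hr.1⟩
      · exact fun hr => ⟨(hlev r hr.1.le).2 hr.2, hr.1⟩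
    rw [radialMeasure_real_of_inter_eq hR.le hlevel, measureReal_def,
      Measure.restrict_apply' measurableSet_Ioi, hlevel, Real.volume_Ioo, sub_zero,
      ENNReal.toReal_ofReal hR.le, indicator_of_mem (by simpa using h0), mul_one]
    refine le_trans ?_ (hreg R hR.le)
    have hcount : ∑ x ∈ F, (Iio (L ‖x‖)).indicator (fun _ => (1:ℝ)) u
        = ((F.filter fun x => ‖x‖ < R).card : ℝ) := by
      rw [Finset.card_filter]
      push_cast
      refine Finset.sum_congr rfl fun x _ => ?_
      simp only [indicator_apply, mem_Iio, hlev _ (norm_nonneg x)]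
    rw [hcount, ← ncard_coe_finset]
    refine Nat.cast_le.2 (ncard_le_ncard (fun x hx => ?_) (hfin R))
    have hx' := Finset.mem_filter.1 (Finset.mem_coe.1 hx)
    exact ⟨hF hx'.1, by simpa using hx'.2⟩

/-- Ball regulation for rational radii extends to all radii: the point count of open balls is
left-continuous in the radius. -/
lemma regulated_of_forall_rat {S : Set Plane} (hfin : ∀ r, (S ∩ Metric.ball 0 r).Finite)
    {σ ρ ν : ℝ} (hreg : ∀ q : ℚ, 0 ≤ (q : ℝ) →
      ((S ∩ Metric.ball 0 (q:ℝ)).ncard : ℝ) ≤ σ + ρ * q + ν * (q:ℝ) ^ 2) (r : ℝ) (hr : 0 ≤ r) :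
    ((S ∩ Metric.ball 0 r).ncard : ℝ) ≤ σ + ρ * r + ν * r ^ 2 := by
  rcases hr.eq_or_lt with rfl | hr
  · simpa using hreg 0 (by simp)
  by_contra hlt
  rw [not_le] at hlt
  have hev1 : ∀ᶠ q in nhdsWithin r (Iio r),
      σ + ρ * q + ν * q ^ 2 < ((S ∩ Metric.ball 0 r).ncard : ℝ) :=
    ((by fun_prop : Continuous fun q : ℝ => σ + ρ * q + ν * q ^ 2).continuousAt.mono_left
      nhdsWithin_le_nhds).eventually_lt_const hlt
  have hev2 : ∀ᶠ q in nhdsWithin r (Iio r), ∀ x ∈ S ∩ Metric.ball (0:Plane) r, ‖x‖ < q :=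
    (Filter.eventually_all_finite (hfin r)).2 fun x hx =>
      (lt_mem_nhds (by simpa using hx.2)).filter_mono nhdsWithin_le_nhds
  have hev3 : ∀ᶠ q in nhdsWithin r (Iio r), 0 < q :=
    (lt_mem_nhds hr).filter_mono nhdsWithin_le_nhds
  obtain ⟨a, ha, hIoo⟩ := (mem_nhdsLT_iff_exists_Ioo_subset).1 (hev1.and (hev2.and hev3))
  obtain ⟨q, hq1, hq2⟩ := exists_rat_btwn (show a < r from ha)
  obtain ⟨h1, h2, h3⟩ := hIoo ⟨hq1, hq2⟩
  have hle : (S ∩ Metric.ball 0 r).ncard ≤ (S ∩ Metric.ball 0 (q:ℝ)).ncard :=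
    ncard_le_ncard (fun x hx => ⟨hx.1, by simpa using h2 x hx⟩) (hfin q)
  have := hreg q h3.le
  have : ((S ∩ Metric.ball 0 r).ncard : ℝ) ≤ (S ∩ Metric.ball 0 (q:ℝ)).ncard := by exact_mod_cast hle
  linarith

/-- Ball regulation at every fixed radius holds simultaneously for all radii. -/
lemma IsBallRegulated.ae_forall {Ω : Type*} [MeasurableSpace Ω] {Q : Measure Ω}
    {Φ : Ω → Set Plane} (hΦ : IsPointProcess Φ)
    {σ ρ ν : ℝ} (hreg : IsBallRegulated Q Φ σ ρ ν) : ∀ᵐ ω ∂Q, ∀ r : ℝ, 0 ≤ r →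
      ((Φ ω ∩ Metric.ball 0 r).ncard : ℝ) ≤ σ + ρ * r + ν * r ^ 2 := by
  have h : ∀ᵐ ω ∂Q, ∀ q : ℚ, 0 ≤ (q : ℝ) →
      ((Φ ω ∩ Metric.ball 0 (q:ℝ)).ncard : ℝ) ≤ σ + ρ * q + ν * (q:ℝ) ^ 2 := by
    refine ae_all_iff.2 fun q => ?_
    by_cases hq : 0 ≤ (q : ℝ)
    · filter_upwards [hreg q hq] with ω hω _ using hω
    · exact Filter.Eventually.of_forall fun ω h => absurd h hq
  filter_upwards [h] with ω hω r hr
  exact regulated_of_forall_rat (hΦ.locallyFinite ω) hω r hr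

/-! ### The logarithmic moment-generating function of the fading -/

section Fading

variable {η : Measure ℝ} {sStar : ℝ}

lemma laplace_neg (η : Measure ℝ) (u : ℝ) : laplace η (-u) = mgf id η u := by
  simp [laplace, mgf]

lemma tildeLoss_eq_log_mgf (η : Measure ℝ) (ℓ : ℝ → ℝ) (s r : ℝ) :
    tildeLoss η ℓ s r = Real.log (mgf id η (s * ℓ r)) := by
  rw [tildeLoss, laplace_neg]

lemma integrable_exp_mul_of_lt (hη_nonneg : ∀ᵐ u ∂η, 0 ≤ u) (hs0 : 0 < sStar)
    (hmgf : FiniteMgfOn η sStar) {u : ℝ} (hu : u < sStar) :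
    Integrable (fun x => Real.exp (u * x)) η := by
  refine (hmgf (max u 0) ⟨le_max_right _ _, max_lt hu hs0⟩).mono' (by fun_prop) ?_
  filter_upwards [hη_nonneg] with x hx
  rw [Real.norm_of_nonneg (Real.exp_pos _).le]
  exact Real.exp_le_exp.2 (mul_le_mul_of_nonneg_right (le_max_left _ _) hx)

lemma continuousOn_mgf_Iio (hη_nonneg : ∀ᵐ u ∂η, 0 ≤ u) (hs0 : 0 < sStar)
    (hmgf : FiniteMgfOn η sStar) : ContinuousOn (mgf id η) (Iio sStar) :=
  continuousOn_mgf.mono (interior_maximal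
    (fun _ hu => integrable_exp_mul_of_lt hη_nonneg hs0 hmgf hu) isOpen_Iio)

lemma mgf_le_mgf (hη_nonneg : ∀ᵐ u ∂η, 0 ≤ u) (hs0 : 0 < sStar) (hmgf : FiniteMgfOn η sStar)
    {u v : ℝ} (huv : u ≤ v) (hv : v < sStar) : mgf id η u ≤ mgf id η v := by
  refine integral_mono_ae (integrable_exp_mul_of_lt hη_nonneg hs0 hmgf (huv.trans_lt hv))
    (integrable_exp_mul_of_lt hη_nonneg hs0 hmgf hv) ?_
  filter_upwards [hη_nonneg] with x hx
  exact Real.exp_le_exp.2 (mul_le_mul_of_nonneg_right huv hx)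

lemma one_le_mgf [IsProbabilityMeasure η] (hη_nonneg : ∀ᵐ u ∂η, 0 ≤ u) (hs0 : 0 < sStar)
    (hmgf : FiniteMgfOn η sStar)
    {u : ℝ} (hu : 0 ≤ u) (hu' : u < sStar) : 1 ≤ mgf id η u := by
  have := mgf_le_mgf hη_nonneg hs0 hmgf hu hu'
  rwa [mgf_zero] at this

/-- Chord bound from the convexity of the moment-generating function. -/
lemma mgf_mul_le [IsProbabilityMeasure η] (hmgf : FiniteMgfOn η sStar) {s a : ℝ} (hs : s ∈ Ico 0 sStar)
    (ha : a ∈ Icc (0:ℝ) 1) : mgf id η (s * a) ≤ 1 + a * (mgf id η s - 1) := by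
  have hpt : ∀ x : ℝ, Real.exp (s * a * x) ≤ 1 + a * (Real.exp (s * x) - 1) := fun x => by
    have := convexOn_exp.2 (mem_univ 0) (mem_univ (s * x)) (sub_nonneg.2 ha.2) ha.1
      (sub_add_cancel 1 a)
    simp only [smul_eq_mul, mul_zero, zero_add, Real.exp_zero, mul_one] at this
    calc Real.exp (s * a * x) = Real.exp (a * (s * x)) := by ring_nf
      _ ≤ _ := this
      _ = _ := by ring
  have hint := hmgf s hs
  have hsa : s * a ∈ Ico 0 sStar :=
    ⟨mul_nonneg hs.1 ha.1, (mul_le_of_le_one_right hs.1 ha.2).trans_lt hs.2⟩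
  have h1 : Integrable (fun x : ℝ => Real.exp (s * x) - 1) η := hint.sub (integrable_const 1)
  have hle := integral_mono (hmgf _ hsa) ((integrable_const 1).add (h1.const_mul a)) hpt
  rw [integral_add' (integrable_const 1) (h1.const_mul a), integral_const_mul,
    integral_sub hint (integrable_const 1)] at hle
  simpa [mgf] using hle

variable {ℓ : ℝ → ℝ}

lemma IsPathLoss.mem_Icc (hℓ : IsPathLoss ℓ) {r : ℝ} (hr : 0 ≤ r) : ℓ r ∈ Icc (0:ℝ) 1 :=
  ⟨hℓ.nonneg r hr, hℓ.at_zero ▸ hℓ.antitone self_mem_Ici hr hr⟩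

lemma IsPathLoss.mul_mem_Ico (hℓ : IsPathLoss ℓ) {s : ℝ} (hs : s ∈ Ico 0 sStar) {r : ℝ}
    (hr : 0 ≤ r) : s * ℓ r ∈ Ico 0 sStar :=
  ⟨mul_nonneg hs.1 (hℓ.mem_Icc hr).1,
    (mul_le_of_le_one_right hs.1 (hℓ.mem_Icc hr).2).trans_lt hs.2⟩

lemma tildeLoss_nonneg [IsProbabilityMeasure η] (hη_nonneg : ∀ᵐ u ∂η, 0 ≤ u) (hs0 : 0 < sStar)
    (hmgf : FiniteMgfOn η sStar) (hℓ : IsPathLoss ℓ) {s : ℝ} (hs : s ∈ Ico 0 sStar)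
    {r : ℝ} (hr : 0 ≤ r) : 0 ≤ tildeLoss η ℓ s r := by
  rw [tildeLoss_eq_log_mgf]
  have := hℓ.mul_mem_Ico hs hr
  exact Real.log_nonneg (one_le_mgf hη_nonneg hs0 hmgf this.1 this.2)

lemma tildeLoss_antitoneOn [IsProbabilityMeasure η] (hη_nonneg : ∀ᵐ u ∂η, 0 ≤ u) (hs0 : 0 < sStar)
    (hmgf : FiniteMgfOn η sStar) (hℓ : IsPathLoss ℓ) {s : ℝ} (hs : s ∈ Ico 0 sStar) :
    AntitoneOn (tildeLoss η ℓ s) (Ici 0) := by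
  intro r hr r' hr' hrr'
  simp only [tildeLoss_eq_log_mgf]
  have h := hℓ.mul_mem_Ico hs hr
  have h' := hℓ.mul_mem_Ico hs hr'
  exact Real.log_le_log (zero_lt_one.trans_le (one_le_mgf hη_nonneg hs0 hmgf h'.1 h'.2))
    (mgf_le_mgf hη_nonneg hs0 hmgf
      (mul_le_mul_of_nonneg_left (hℓ.antitone hr hr' hrr') hs.1) h.2)

lemma tildeLoss_continuousOn [IsProbabilityMeasure η] (hη_nonneg : ∀ᵐ u ∂η, 0 ≤ u) (hs0 : 0 < sStar)
    (hmgf : FiniteMgfOn η sStar) (hℓ : IsPathLoss ℓ) {s : ℝ} (hs : s ∈ Ico 0 sStar) :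
    ContinuousOn (tildeLoss η ℓ s) (Ici 0) := by
  have h1 : ContinuousOn (fun r => mgf id η (s * ℓ r)) (Ici 0) :=
    (continuousOn_mgf_Iio hη_nonneg hs0 hmgf).comp (continuousOn_const.mul hℓ.continuous)
      fun r hr => (hℓ.mul_mem_Ico hs hr).2
  refine (h1.log fun r hr => ?_).congr fun r _ => tildeLoss_eq_log_mgf η ℓ s r
  have h := hℓ.mul_mem_Ico hs hr
  exact (zero_lt_one.trans_le (one_le_mgf hη_nonneg hs0 hmgf h.1 h.2)).ne'

/-- The modified path loss is dominated by a multiple of the path loss, hence inherits its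
integrability. -/
lemma tildeLoss_le [IsProbabilityMeasure η] (hη_nonneg : ∀ᵐ u ∂η, 0 ≤ u) (hs0 : 0 < sStar)
    (hmgf : FiniteMgfOn η sStar) (hℓ : IsPathLoss ℓ) {s : ℝ} (hs : s ∈ Ico 0 sStar)
    {r : ℝ} (hr : 0 ≤ r) : tildeLoss η ℓ s r ≤ (mgf id η s - 1) * ℓ r := by
  rw [tildeLoss_eq_log_mgf]
  have h := hℓ.mul_mem_Ico hs hr
  have h1 := Real.log_le_sub_one_of_pos
    (zero_lt_one.trans_le (one_le_mgf hη_nonneg hs0 hmgf h.1 h.2))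
  have h2 := mgf_mul_le hmgf hs (hℓ.mem_Icc hr)
  linarith

lemma integrableOn_mul_tildeLoss [IsProbabilityMeasure η] (hη_nonneg : ∀ᵐ u ∂η, 0 ≤ u) (hs0 : 0 < sStar)
    (hmgf : FiniteMgfOn η sStar) (hℓ : IsPathLoss ℓ) {s : ℝ} (hs : s ∈ Ico 0 sStar) :
    IntegrableOn (fun r => r * tildeLoss η ℓ s r) (Ioi 0) := by
  have hcont := (tildeLoss_continuousOn hη_nonneg hs0 hmgf hℓ hs).mono Ioi_subset_Ici_self
  refine Integrable.mono' (hℓ.integrable.const_mul (mgf id η s - 1))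
    ((continuousOn_id.mul hcont).aestronglyMeasurable measurableSet_Ioi) ?_
  filter_upwards [ae_restrict_mem measurableSet_Ioi] with r hr
  have h0 : (0:ℝ) ≤ r := le_of_lt hr
  have h1 := tildeLoss_nonneg hη_nonneg hs0 hmgf hℓ hs h0
  rw [Real.norm_of_nonneg (mul_nonneg h0 h1)]
  calc r * tildeLoss η ℓ s r ≤ r * ((mgf id η s - 1) * ℓ r) :=
        mul_le_mul_of_nonneg_left (tildeLoss_le hη_nonneg hs0 hmgf hℓ hs h0) h0
    _ = _ := by ring

lemma integrableOn_tildeLoss [IsProbabilityMeasure η] (hη_nonneg : ∀ᵐ u ∂η, 0 ≤ u) (hs0 : 0 < sStar)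
    (hmgf : FiniteMgfOn η sStar) (hℓ : IsPathLoss ℓ) {s : ℝ} (hs : s ∈ Ico 0 sStar) :
    IntegrableOn (tildeLoss η ℓ s) (Ioi 0) := by
  have hcont := tildeLoss_continuousOn hη_nonneg hs0 hmgf hℓ hs
  rw [← Ioc_union_Ioi_eq_Ioi zero_le_one]
  refine IntegrableOn.union ?_ ?_
  · exact ((hcont.mono Icc_subset_Ici_self).integrableOn_Icc).mono_set Ioc_subset_Icc_self
  · have hsub : Ioi (1:ℝ) ⊆ Ioi 0 := Ioi_subset_Ioi zero_le_one
    refine Integrable.mono' ((integrableOn_mul_tildeLoss hη_nonneg hs0 hmgf hℓ hs).mono_set hsub)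
      ((hcont.mono (hsub.trans Ioi_subset_Ici_self)).aestronglyMeasurable measurableSet_Ioi) ?_
    filter_upwards [ae_restrict_mem measurableSet_Ioi] with r hr
    have h1r : (1:ℝ) < r := hr
    have h1 := tildeLoss_nonneg hη_nonneg hs0 hmgf hℓ hs (zero_le_one.trans h1r.le)
    rw [Real.norm_of_nonneg h1]
    exact le_mul_of_one_le_left h1 h1r.le

/-- The shot-noise bound for the modified path loss, with the contribution of the dedicated
transmitter `t` taken out. -/
lemma sum_tildeLoss_le [IsProbabilityMeasure η] (hη_nonneg : ∀ᵐ u ∂η, 0 ≤ u) (hs0 : 0 < sStar)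
    (hmgf : FiniteMgfOn η sStar) (hℓ : IsPathLoss ℓ) {s : ℝ} (hs : s ∈ Ico 0 sStar)
    {S : Set Plane} (hfin : ∀ r, (S ∩ Metric.ball 0 r).Finite) {σ ρ ν : ℝ}
    (hreg : ∀ r : ℝ, 0 ≤ r → ((S ∩ Metric.ball 0 r).ncard : ℝ) ≤ σ + ρ * r + ν * r ^ 2)
    {t : Plane} (ht : t ∈ S) (F : Finset Plane) (hF : ↑F ⊆ S \ {t}) :
    ∑ x ∈ F, tildeLoss η ℓ s ‖x‖
      ≤ shotNoiseBound σ ρ ν (tildeLoss η ℓ s) - tildeLoss η ℓ s ‖t‖ := by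
  classical
  have htF : t ∉ F := fun h => (hF h).2 rfl
  have h := sum_le_shotNoiseBound hfin hreg (tildeLoss_continuousOn hη_nonneg hs0 hmgf hℓ hs)
    (tildeLoss_antitoneOn hη_nonneg hs0 hmgf hℓ hs)
    (fun r hr => tildeLoss_nonneg hη_nonneg hs0 hmgf hℓ hs hr)
    (integrableOn_tildeLoss hη_nonneg hs0 hmgf hℓ hs)
    (integrableOn_mul_tildeLoss hη_nonneg hs0 hmgf hℓ hs) (insert t F) (by
      rw [Finset.coe_insert]
      exact insert_subset ht (hF.trans sdiff_subset))
  rw [Finset.sum_insert htF] at h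
  linarith

end Fading

/-! ### Chernoff bound for a fixed configuration -/

section Chernoff

variable {Ω : Type*} [MeasurableSpace Ω] {Q : Measure Ω}
  {η : Measure ℝ} {H : ℕ → Ω → ℝ} {a : ℕ → ℝ}

lemma measureReal_weighted_sum_ge_le [IsProbabilityMeasure Q]
    (hH : ∀ n, Measurable (H n)) (hlaw : ∀ n, Q.map (H n) = η)
    (hind : iIndepFun H Q) {s : ℝ} (hs : 0 ≤ s)
    (hint : ∀ n, Integrable (fun x => Real.exp (s * a n * x)) η) {B : ℝ} {F : Finset ℕ}
    (hB : ∑ n ∈ F, Real.log (mgf id η (s * a n)) ≤ B) (y : ℝ) :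
    Q.real {ω | y ≤ ∑ n ∈ F, H n ω * a n} ≤ Real.exp (B - s * y) := by
  have hη : IsProbabilityMeasure η := hlaw 0 ▸ Measure.isProbabilityMeasure_map (hH 0).aemeasurable
  set Y : ℕ → Ω → ℝ := fun n ω => H n ω * a n with hY
  have hYm : ∀ n, Measurable (Y n) := fun n => (hH n).mul_const _
  have hYind : iIndepFun Y Q := hind.comp (fun n x => x * a n) fun n => by fun_prop
  have hYint : ∀ n, Integrable (fun ω => Real.exp (s * Y n ω)) Q := fun n => by
    have h := hint n
    rw [← hlaw n] at h
    refine (h.comp_measurable (hH n)).congr (Filter.Eventually.of_forall fun ω => ?_)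
    simp only [Function.comp, hY]
    ring_nf
  have hYmgf : ∀ n, mgf (Y n) Q s = mgf id η (s * a n) := fun n => by
    rw [← hlaw n, mgf_id_map (hH n).aemeasurable]
    simp only [mgf, hY]
    congr with ω
    ring_nf
  have hsumint : Integrable (fun ω => Real.exp (s * (∑ n ∈ F, Y n) ω)) Q :=
    hYind.integrable_exp_mul_sum hYm fun n _ => hYint n
  have hpos : ∀ n, 0 < mgf id η (s * a n) := fun n => mgf_pos (hint n)
  have h := measure_ge_le_exp_mul_mgf (X := ∑ n ∈ F, Y n) y hs hsumint
  rw [hYind.mgf_sum hYm] at h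
  simp only [Finset.sum_apply, hYmgf] at h
  refine h.trans ?_
  rw [← Real.exp_log (Finset.prod_pos fun n _ => hpos n), ← Real.exp_add,
    Real.log_prod fun n _ => (hpos n).ne']
  refine Real.exp_le_exp.2 ?_
  linarith

/-- The total of the weighted marks other than the one of index `N`. -/
noncomputable def weightedTotal (a : ℕ → ℝ) (N : ℕ) (u : ℕ → ℝ) : ℝ≥0∞ :=
  ∑' n, if n = N then 0 else ENNReal.ofReal (u n * a n)

/-- Chernoff bound for the total of infinitely many weighted marks, obtained from the one for
finite sums by monotone convergence. -/
lemma measure_weightedTotal_ge_le [IsProbabilityMeasure Q]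
    (hH : ∀ n, Measurable (H n)) (hlaw : ∀ n, Q.map (H n) = η)
    (hind : iIndepFun H Q) (hη_nonneg : ∀ᵐ u ∂η, 0 ≤ u) (ha : ∀ n, 0 ≤ a n)
    {s : ℝ} (hs : 0 ≤ s)
    (hint : ∀ n, Integrable (fun x => Real.exp (s * a n * x)) η) {B : ℝ} {N : ℕ}
    (hB : ∀ F : Finset ℕ, N ∉ F → ∑ n ∈ F, Real.log (mgf id η (s * a n)) ≤ B) {y : ℝ}
    (hy : 0 < y) :
    Q {ω | ENNReal.ofReal y ≤ weightedTotal a N fun n => H n ω}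
      ≤ ENNReal.ofReal (Real.exp (B - s * y)) := by
  have hHnn : ∀ᵐ ω ∂Q, ∀ n, 0 ≤ H n ω := by
    refine ae_all_iff.2 fun n => ?_
    rw [← hlaw n] at hη_nonneg
    exact ae_of_ae_map (hH n).aemeasurable hη_nonneg
  have hstep : ∀ y' < y, Q {ω | ENNReal.ofReal y ≤ weightedTotal a N fun n => H n ω}
      ≤ ENNReal.ofReal (Real.exp (B - s * y')) := by
    intro y' hy'
    set T : ℕ → Ω → ℝ≥0∞ := fun k ω =>
      ∑ n ∈ Finset.range k, if n = N then 0 else ENNReal.ofReal (H n ω * a n)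
    have hmono : Monotone fun k => {ω | ENNReal.ofReal y' < T k ω} := fun k l hkl ω
        (hω : ENNReal.ofReal y' < T k ω) => lt_of_lt_of_le (b := T k ω) hω
        (Finset.sum_le_sum_of_subset (Finset.range_mono hkl))
    have hsub : {ω | ENNReal.ofReal y ≤ weightedTotal a N fun n => H n ω}
        ⊆ ⋃ k, {ω | ENNReal.ofReal y' < T k ω} := by
      intro ω hω
      have hlt : ENNReal.ofReal y' < weightedTotal a N fun n => H n ω :=
        lt_of_lt_of_le ((ENNReal.ofReal_lt_ofReal_iff hy).2 hy') hω
      rw [weightedTotal, ENNReal.tsum_eq_iSup_nat] at hlt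
      exact mem_iUnion.2 (lt_iSup_iff.1 hlt)
    refine (measure_mono hsub).trans ?_
    rw [hmono.measure_iUnion]
    refine iSup_le fun k => ?_
    have hF : N ∉ (Finset.range k).erase N := Finset.notMem_erase _ _
    have hle := measureReal_weighted_sum_ge_le hH hlaw hind hs hint (hB _ hF) y'
    rw [← ofReal_measureReal]
    refine ENNReal.ofReal_le_ofReal (le_trans ?_ hle)
    refine ENNReal.toReal_mono (measure_ne_top _ _) (measure_mono_ae ?_)
    filter_upwards [hHnn] with ω hω hlt
    have hTk : T k ω = ENNReal.ofReal (∑ n ∈ (Finset.range k).erase N, H n ω * a n) := by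
      rw [ENNReal.ofReal_sum_of_nonneg fun n _ => mul_nonneg (hω n) (ha n),
        ← Finset.filter_ne', Finset.sum_filter]
      exact Finset.sum_congr rfl fun n _ => by by_cases h : n = N <;> simp [h]
    have hlt' : ENNReal.ofReal y' < T k ω := hlt
    rw [hTk] at hlt'
    exact (not_le.1 fun h => not_le.2 hlt' (ENNReal.ofReal_le_ofReal h)).le
  have hcont : Continuous fun y' : ℝ => ENNReal.ofReal (Real.exp (B - s * y')) :=
    ENNReal.continuous_ofReal.comp (by fun_prop)
  refine ge_of_tendsto ((hcont.tendsto y).mono_left (nhdsWithin_le_nhds (s := Iio y))) ?_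
  filter_upwards [self_mem_nhdsWithin] with y' hy' using hstep y' hy'

lemma measurable_weightedTotal {Ω : Type*} {_ : MeasurableSpace Ω} {H : ℕ → Ω → ℝ} {N : ℕ}
    (hH : ∀ n, n ≠ N → Measurable (H n)) :
    Measurable fun ω => weightedTotal a N fun n => H n ω := by
  refine Measurable.tsum fun n => ?_
  by_cases h : n = N
  · simp [h]
  · simpa [h] using ((hH n h).mul_const (a n)).ennreal_ofReal

lemma indepFun_weightedTotal (hH : ∀ n, Measurable (H n)) (hind : iIndepFun H Q) (N : ℕ) :
    IndepFun (H N) (fun ω => weightedTotal a N fun n => H n ω) Q := by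
  have h := indep_iSup_of_disjoint (fun n => (hH n).comap_le) hind
    (S := {N}) (T := {N}ᶜ) disjoint_compl_right
  refine (IndepFun_iff_Indep _ _ _).2 (indep_of_indep_of_le_left
    (indep_of_indep_of_le_right h ?_) ?_)
  · refine Measurable.comap_le (measurable_weightedTotal fun n hn => ?_)
    exact Measurable.mono (comap_measurable (H n)) (le_iSup₂_of_le n hn le_rfl) le_rfl
  · exact le_iSup₂_of_le N rfl le_rfl

/-- Conditioning on the mark of index `N`, which has density `f` and is independent of the other
marks, and bounding the remaining probability by Chernoff's inequality at the best exponent. -/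
lemma ofReal_zeta_le_measure [IsProbabilityMeasure Q] (hH : ∀ n, Measurable (H n))
    (hlaw : ∀ n, Q.map (H n) = η) (hind : iIndepFun H Q) (hη_nonneg : ∀ᵐ u ∂η, 0 ≤ u)
    (ha : ∀ n, 0 ≤ a n) {f : ℝ → ℝ} (hf : Measurable f) (hf_nonneg : ∀ x, 0 ≤ f x)
    (hη_density : η = volume.withDensity fun x => ENNReal.ofReal (f x))
    {ℓ : ℝ → ℝ} {τ W σ ρ ν sStar θ : ℝ} (hℓτ : 0 < ℓ τ) (hW : 0 ≤ W) (hθ : 0 < θ)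
    (hs0 : 0 < sStar)
    (hint : ∀ s ∈ Ico 0 sStar, ∀ n, Integrable (fun x => Real.exp (s * a n * x)) η) {N : ℕ}
    (hB : ∀ s ∈ Ico 0 sStar, ∀ F : Finset ℕ, N ∉ F → ∑ n ∈ F, Real.log (mgf id η (s * a n))
      ≤ shotNoiseBound σ ρ ν (tildeLoss η ℓ s) - tildeLoss η ℓ s τ)
    (hzeta : IntegrableOn (zetaIntegrand f η ℓ τ W σ ρ ν sStar θ) (Ioi (W * θ / ℓ τ))) :
    ENNReal.ofReal (zeta f η ℓ τ W σ ρ ν sStar θ) ≤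
      Q {ω | ENNReal.ofReal θ * (weightedTotal a N (fun n => H n ω) + ENNReal.ofReal W)
        < ENNReal.ofReal (H N ω * ℓ τ)} := by
  set J : Ω → ℝ≥0∞ := fun ω => weightedTotal a N fun n => H n ω with hJ
  have hJm : Measurable J := measurable_weightedTotal fun n _ => hH n
  have hη : IsProbabilityMeasure η := hlaw 0 ▸ Measure.isProbabilityMeasure_map (hH 0).aemeasurable
  set E : Set (ℝ × ℝ≥0∞) :=
    {p | ENNReal.ofReal θ * (p.2 + ENNReal.ofReal W) < ENNReal.ofReal (p.1 * ℓ τ)} with hE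
  have hEm : MeasurableSet E := measurableSet_lt (by fun_prop) (by fun_prop)
  have hprod := (indepFun_iff_map_prod_eq_prod_map_map (hH N).aemeasurable hJm.aemeasurable).1
    (indepFun_weightedTotal (a := a) hH hind N)
  have hprob : Q {ω | ENNReal.ofReal θ * (J ω + ENNReal.ofReal W) < ENNReal.ofReal (H N ω * ℓ τ)}
      = ∫⁻ x, Q.map J (Prod.mk x ⁻¹' E) ∂η := by
    rw [← hlaw N, ← Measure.prod_apply hEm, ← hprod,
      Measure.map_apply ((hH N).prodMk hJm) hEm]
    rfl
  have hGm : Measurable fun x => Q.map J (Prod.mk x ⁻¹' E) := measurable_measure_prodMk_left hEm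
  have hpt : ∀ x ∈ Ioi (W * θ / ℓ τ), ENNReal.ofReal (max 0 (1 - Real.exp
      (⨅ s : Ico (0:ℝ) sStar, chernoffExponent η ℓ τ W σ ρ ν θ x s)))
      ≤ Q.map J (Prod.mk x ⁻¹' E) := by
    intro x hx
    have hy : 0 < x * ℓ τ / θ - W := by
      have h1 : W * θ < x * ℓ τ := (div_lt_iff₀ hℓτ).1 hx
      have h2 := (lt_div_iff₀ hθ).2 h1
      linarith
    set y := x * ℓ τ / θ - W with hydef
    have hsub : {ω | ENNReal.ofReal y ≤ J ω}ᶜ ⊆ J ⁻¹' (Prod.mk x ⁻¹' E) := by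
      intro ω hω
      have hlt : J ω < ENNReal.ofReal y := not_le.1 hω
      change ENNReal.ofReal θ * (J ω + ENNReal.ofReal W) < ENNReal.ofReal (x * ℓ τ)
      have hxy : x * ℓ τ = θ * (y + W) := by
        rw [hydef]
        field_simp
        ring
      rw [hxy, ENNReal.ofReal_mul hθ.le, ENNReal.ofReal_add hy.le hW]
      exact ENNReal.mul_lt_mul_right (ENNReal.ofReal_pos.2 hθ).ne' ENNReal.ofReal_ne_top
        (ENNReal.add_lt_add_right ENNReal.ofReal_ne_top hlt)
    have hJle : MeasurableSet {ω | ENNReal.ofReal y ≤ J ω} := measurableSet_le measurable_const hJm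
    have hexp : ∀ s ∈ Ico 0 sStar, Q.real {ω | ENNReal.ofReal y ≤ J ω}
        ≤ Real.exp (chernoffExponent η ℓ τ W σ ρ ν θ x s) := fun s hs =>
      ENNReal.toReal_le_of_le_ofReal (Real.exp_pos _).le
        (measure_weightedTotal_ge_le hH hlaw hind hη_nonneg ha hs.1 (hint s hs) (hB s hs) hy)
    have hinf : Q.real {ω | ENNReal.ofReal y ≤ J ω} ≤ Real.exp
        (⨅ s : Ico (0:ℝ) sStar, chernoffExponent η ℓ τ W σ ρ ν θ x s) := by
      rcases measureReal_nonneg.eq_or_lt with h0 | h0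
      · exact h0 ▸ (Real.exp_pos _).le
      · rw [← Real.log_le_iff_le_exp h0]
        have : Nonempty (Ico (0:ℝ) sStar) := ⟨⟨0, le_rfl, hs0⟩⟩
        exact le_ciInf fun s => (Real.log_le_iff_le_exp h0).2 (hexp s s.2)
    rw [Measure.map_apply hJm (measurable_prodMk_left hEm)]
    refine le_trans ?_ (measure_mono hsub)
    rw [← ofReal_measureReal, probReal_compl_eq_one_sub hJle]
    exact ENNReal.ofReal_le_ofReal (max_le (sub_nonneg.2 measureReal_le_one) (by linarith))
  have hdens : ∫⁻ x, Q.map J (Prod.mk x ⁻¹' E) ∂η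
      = ∫⁻ x, ENNReal.ofReal (f x) * Q.map J (Prod.mk x ⁻¹' E) := by
    rw [hη_density, lintegral_withDensity_eq_lintegral_mul _ (by fun_prop) hGm]
    rfl
  rw [hprob, hdens, zeta, ofReal_integral_eq_lintegral_ofReal hzeta
      (Filter.Eventually.of_forall fun x => mul_nonneg (hf_nonneg x) (le_max_left _ _))]
  refine le_trans (setLIntegral_mono' measurableSet_Ioi fun x hx => ?_) (setLIntegral_le_lintegral _ _)
  rw [zetaIntegrand, ENNReal.ofReal_mul (hf_nonneg x)]
  exact mul_le_mul_right (hpt x hx) _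

end Chernoff

/-! ### Lower bounds for conditional probabilities -/

/-- If `H` is independent of `𝒢`, then a lower bound for the probability that `(y, H)` lies in
`E`, valid for almost every value `y` of the `𝒢`-measurable variable `Y`, is a lower bound for the
conditional probability of `(Y, H) ∈ E` given any sub-`σ`-algebra of `𝒢`. -/
lemma le_condExp_of_indep {Ω S T : Type*} {m 𝒢 : MeasurableSpace Ω} [mΩ : MeasurableSpace Ω]
    [MeasurableSpace S] [MeasurableSpace T] {Q : Measure Ω} [IsProbabilityMeasure Q]
    (hm : m ≤ 𝒢) (h𝒢 : 𝒢 ≤ mΩ) {Y : Ω → S} (hY : Measurable[𝒢] Y) {H : Ω → T}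
    (hH : Measurable H) (hind : Indep (MeasurableSpace.comap H inferInstance) 𝒢 Q)
    {E : Set (S × T)} (hE : MeasurableSet E) {c : ℝ} (hc : 0 ≤ c)
    (hle : ∀ᵐ ω ∂Q, ENNReal.ofReal c ≤ Q.map H (Prod.mk (Y ω) ⁻¹' E)) {A : Set Ω}
    (hA : A =ᵐ[Q] {ω | (Y ω, H ω) ∈ E}) : ∀ᵐ ω ∂Q, c ≤ (Q⟦A | m⟧) ω := by
  set A' : Set Ω := {ω | (Y ω, H ω) ∈ E} with hA'
  have hYΩ : Measurable Y := hY.mono h𝒢 le_rfl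
  have hA'm : MeasurableSet A' := (hYΩ.prodMk hH) hE
  have hint : Integrable (A'.indicator fun _ => (1:ℝ)) Q := (integrable_const 1).indicator hA'm
  have hmΩ := hm.trans h𝒢
  have hcongr : Q⟦A | m⟧ =ᵐ[Q] Q⟦A' | m⟧ := condExp_congr_ae (indicator_ae_eq_of_ae_eq_set hA)
  have hset : ∀ G, MeasurableSet[m] G → ENNReal.ofReal c * Q G ≤ Q (A' ∩ G) := by
    intro G hG
    have hG𝒢 : MeasurableSet[𝒢] G := hm _ hG
    have hGΩ : MeasurableSet G := h𝒢 _ hG𝒢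
    set Y' : Ω → S × Prop := fun ω => (Y ω, ω ∈ G) with hY'
    have hY'𝒢 : Measurable[𝒢] Y' :=
      Measurable.prodMk hY ((@measurableSet_setOfPred Ω 𝒢 (· ∈ G)).1 hG𝒢)
    have hY'Ω : Measurable Y' := hY'𝒢.mono h𝒢 le_rfl
    have hindep : IndepFun Y' H Q := (IndepFun_iff_Indep _ _ _).2
      (indep_of_indep_of_le_left hind.symm hY'𝒢.comap_le)
    have hprod := (indepFun_iff_map_prod_eq_prod_map_map hY'Ω.aemeasurable hH.aemeasurable).1 hindep
    set E' : Set ((S × Prop) × T) := {p | (p.1.1, p.2) ∈ E ∧ p.1.2} with hE'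
    have hE'm : MeasurableSet E' := by
      refine MeasurableSet.inter ?_ ?_
      · exact (by fun_prop : Measurable fun p : (S × Prop) × T => (p.1.1, p.2)) hE
      · exact measurableSet_setOfPred.2 (by fun_prop : Measurable fun p : (S × Prop) × T => p.1.2)
    have hval : Q (A' ∩ G) = ∫⁻ ω, Q.map H (Prod.mk (Y' ω) ⁻¹' E') ∂Q := by
      have h1 : Q (A' ∩ G) = Q.map (fun ω => (Y' ω, H ω)) E' := by
        rw [Measure.map_apply (hY'Ω.prodMk hH) hE'm]
        rfl
      rw [h1, hprod, Measure.prod_apply hE'm,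
        lintegral_map (measurable_measure_prodMk_left hE'm) hY'Ω]
    rw [hval, ← setLIntegral_const]
    refine le_trans ?_ (setLIntegral_le_lintegral G _)
    refine lintegral_mono_ae ?_
    filter_upwards [ae_restrict_of_ae hle, ae_restrict_mem hGΩ] with ω hω hωG
    refine hω.trans (measure_mono fun u hu => ⟨hu, hωG⟩)
  have htrim : (fun _ => c) ≤ᵐ[Q.trim hmΩ] Q⟦A' | m⟧ := by
    refine ae_le_of_forall_setIntegral_le (integrable_const c)
      (integrable_condExp.trim hmΩ stronglyMeasurable_condExp) fun G hG _ => ?_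
    rw [← setIntegral_trim hmΩ stronglyMeasurable_condExp hG,
      ← setIntegral_trim hmΩ stronglyMeasurable_const hG, setIntegral_condExp hmΩ hint hG,
      setIntegral_indicator hA'm]
    simp only [setIntegral_const, smul_eq_mul, mul_one]
    have h := ENNReal.toReal_mono (measure_ne_top Q _) (hset G hG)
    rw [ENNReal.toReal_mul, ENNReal.toReal_ofReal hc] at h
    rw [mul_comm, inter_comm]
    exact h
  filter_upwards [ae_le_of_ae_le_trim htrim, hcongr] with ω h1 h2
  rw [h2]
  exact h1

/-! ### The Palm probability -/

section Palm

variable {Ω : Type*} [MeasurableSpace Ω] [AddAction Plane Ω] [MeasurableVAdd₂ Plane Ω]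
  {P : Measure Ω} {Ψ : Ω → Set Plane}

lemma isProbabilityMeasure_palm (hΨ : IsPointProcess Ψ) (h0 : 0 < intensity P Ψ)
    (hfin : intensity P Ψ < ∞) : IsProbabilityMeasure (palm P Ψ) := by
  constructor
  rw [palm_apply P hΨ MeasurableSet.univ]
  simp only [mem_univ, ofPred_true, univ_inter]
  exact ENNReal.inv_mul_cancel h0.ne' hfin.ne

/-- Under its Palm probability a flow-compatible point process has a point at the origin. -/
lemma zero_mem_ae_palm (hΨ : IsPointProcess Ψ) (hflow : IsFlowCompatible Ψ) :
    ∀ᵐ ω ∂(palm P Ψ), (0 : Plane) ∈ Ψ ω := by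
  set A : Set Ω := {ω | pointMeasure (Ψ ω) {0} = 0} with hA
  have hAm : MeasurableSet A :=
    ((Measure.measurable_coe (measurableSet_singleton 0)).comp hΨ.measurable)
      (measurableSet_singleton 0)
  have hmem : ∀ ω, (0 : Plane) ∉ Ψ ω → ω ∈ A := fun ω hω => by
    change pointMeasure (Ψ ω) {0} = 0
    rw [pointMeasure, Measure.restrict_apply (measurableSet_singleton 0),
      singleton_inter_eq_empty.2 hω, measure_empty]
  have hnotMem : ∀ ω ∈ A, (0 : Plane) ∉ Ψ ω := fun ω hω h0 => by
    have h1 : pointMeasure (Ψ ω) {0} = 0 := hω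
    rw [pointMeasure, Measure.restrict_apply (measurableSet_singleton 0),
      singleton_inter_of_mem h0, Measure.count_singleton] at h1
    exact one_ne_zero h1
  have hzero : palm P Ψ A = 0 := by
    rw [palm_apply P hΨ hAm, lintegral_eq_zero_of_ae_eq_zero, mul_zero]
    refine Filter.Eventually.of_forall fun ω => ?_
    have hAω : MeasurableSet {y : Plane | y +ᵥ ω ∈ A} :=
      (by fun_prop : Measurable fun y : Plane => y +ᵥ ω) hAm
    change pointMeasure (Ψ ω) ({y | y +ᵥ ω ∈ A} ∩ unitSquare) = 0
    rw [pointMeasure, Measure.restrict_apply (hAω.inter measurableSet_unitSquare)]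
    convert measure_empty (μ := Measure.count)
    refine eq_empty_of_forall_notMem fun y hy => hnotMem _ hy.1.1 ?_
    rw [hflow y ω 0, zero_add]
    exact hy.2
  exact measure_mono_null hmem hzero

end Palm

/-! ### The bound `ζ(θ)` -/

section Zeta

variable {η : Measure ℝ} {f : ℝ → ℝ} {ℓ : ℝ → ℝ}
  {τ W σ ρ ν sStar θ : ℝ}

lemma integrable_density [IsProbabilityMeasure η] {f : ℝ → ℝ} (hf : Measurable f) (hf_nonneg : ∀ x, 0 ≤ f x)
    (hη_density : η = volume.withDensity fun x => ENNReal.ofReal (f x)) : Integrable f := by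
  refine ⟨hf.aestronglyMeasurable, ?_⟩
  rw [hasFiniteIntegral_iff_ofReal (Filter.Eventually.of_forall hf_nonneg),
    ← setLIntegral_univ, ← withDensity_apply _ MeasurableSet.univ, ← hη_density]
  exact measure_lt_top _ _

/-- The Chernoff exponent is bounded below: by the shot-noise bound, the part of it that does not
involve the threshold dominates a sum of non-negative terms, here the empty one. -/
lemma bddBelow_chernoffExponent
    (hC : ∀ s ∈ Ico 0 sStar,
      0 ≤ shotNoiseBound σ ρ ν (tildeLoss η ℓ s) - tildeLoss η ℓ s τ) (x : ℝ) :
    BddBelow (chernoffExponent η ℓ τ W σ ρ ν θ x '' Ico 0 sStar) := by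
  refine ⟨-(sStar * |x * ℓ τ / θ - W|), ?_⟩
  rintro _ ⟨s, hs, rfl⟩
  rw [chernoffExponent]
  have h1 := hC s hs
  have h2 : s * (x * ℓ τ / θ - W) ≤ sStar * |x * ℓ τ / θ - W| :=
    (mul_le_mul_of_nonneg_left (le_abs_self _) hs.1).trans
      (mul_le_mul_of_nonneg_right hs.2.le (abs_nonneg _))
  linarith

lemma bddBelow_range_chernoffExponent
    {x : ℝ} (h : BddBelow (chernoffExponent η ℓ τ W σ ρ ν θ x '' Ico 0 sStar)) :
    BddBelow (range fun s : Ico (0:ℝ) sStar => chernoffExponent η ℓ τ W σ ρ ν θ x s) := by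
  rwa [image_eq_range] at h

lemma zetaIntegrand_nonneg (hf_nonneg : ∀ x, 0 ≤ f x) (x : ℝ) :
    0 ≤ zetaIntegrand f η ℓ τ W σ ρ ν sStar θ x :=
  mul_nonneg (hf_nonneg x) (le_max_left _ _)

lemma zetaWellDefined [IsProbabilityMeasure η] (hη_nonneg : ∀ᵐ u ∂η, 0 ≤ u) (hs0 : 0 < sStar)
    (hmgf : FiniteMgfOn η sStar) (hℓ : IsPathLoss ℓ) (hℓτ : 0 < ℓ τ) (hθ : 0 < θ)
    (hf : Measurable f) (hf_nonneg : ∀ x, 0 ≤ f x)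
    (hη_density : η = volume.withDensity fun x => ENNReal.ofReal (f x))
    (hC : ∀ s ∈ Ico 0 sStar,
      0 ≤ shotNoiseBound σ ρ ν (tildeLoss η ℓ s) - tildeLoss η ℓ s τ) :
    ZetaWellDefined f η ℓ τ W σ ρ ν sStar θ where
  integrable_tilde s hs := integrableOn_tildeLoss hη_nonneg hs0 hmgf hℓ hs
  integrable_mul_tilde s hs := integrableOn_mul_tildeLoss hη_nonneg hs0 hmgf hℓ hs
  bddBelow x _ := bddBelow_chernoffExponent hC x
  integrable := by
    -- The infimum of the exponents, each non-increasing in `x`, is measurable by monotonicity.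
    have hanti : Antitone fun x => ⨅ s : Ico (0:ℝ) sStar,
        chernoffExponent η ℓ τ W σ ρ ν θ x s := fun x x' hxx' => by
      refine ciInf_mono (bddBelow_range_chernoffExponent (bddBelow_chernoffExponent hC x'))
        fun s => ?_
      simp only [chernoffExponent]
      have : x * ℓ τ / θ ≤ x' * ℓ τ / θ := by gcongr
      have := mul_le_mul_of_nonneg_left (sub_le_sub_right this W) s.2.1
      linarith
    have hmeas : Measurable (zetaIntegrand f η ℓ τ W σ ρ ν sStar θ) :=
      hf.mul (measurable_const.max
        (measurable_const.sub (Real.measurable_exp.comp hanti.measurable)))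
    refine Integrable.integrableOn
      ((integrable_density hf hf_nonneg hη_density).mono' hmeas.aestronglyMeasurable ?_)
    refine Filter.Eventually.of_forall fun x => ?_
    rw [Real.norm_of_nonneg (zetaIntegrand_nonneg hf_nonneg x), zetaIntegrand]
    refine mul_le_of_le_one_right (hf_nonneg x) (max_le zero_le_one ?_)
    linarith [Real.exp_pos (⨅ s : Ico (0:ℝ) sStar, chernoffExponent η ℓ τ W σ ρ ν θ x s)]

lemma zeta_nonneg (hf_nonneg : ∀ x, 0 ≤ f x) : 0 ≤ zeta f η ℓ τ W σ ρ ν sStar θ :=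
  integral_nonneg fun x => zetaIntegrand_nonneg hf_nonneg x

/-- The bound `ζ(θ)` tends to `1` as `θ → 0`: the fading exceeds some `a > 0` with probability close
to `1`, and on this event the Chernoff bound at one fixed exponent is already small. -/
lemma exists_forall_lt_zeta [IsProbabilityMeasure η] (hη_nonneg : ∀ᵐ u ∂η, 0 ≤ u) (hs0 : 0 < sStar)
    (hmgf : FiniteMgfOn η sStar) (hℓ : IsPathLoss ℓ) (hℓτ : 0 < ℓ τ) (hW : 0 ≤ W)
    (hf : Measurable f) (hf_nonneg : ∀ x, 0 ≤ f x)
    (hη_density : η = volume.withDensity fun x => ENNReal.ofReal (f x))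
    (hC : ∀ s ∈ Ico 0 sStar,
      0 ≤ shotNoiseBound σ ρ ν (tildeLoss η ℓ s) - tildeLoss η ℓ s τ) {ε : ℝ} (hε : 0 < ε) :
    ∃ δ : ℝ, 0 < δ ∧ ∀ θ : ℝ, 0 < θ → θ ≤ δ → 1 - ε < zeta f η ℓ τ W σ ρ ν sStar θ := by
  rcases lt_or_ge 1 ε with h1ε | hε1
  · exact ⟨1, one_pos, fun θ _ _ => (sub_neg.2 h1ε).trans_le (zeta_nonneg hf_nonneg)⟩
  have hfint := integrable_density hf hf_nonneg hη_density
  have hreal : ∀ a : ℝ, ∫ x in Ioi a, f x = η.real (Ioi a) := fun a => by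
    rw [measureReal_def, hη_density, withDensity_apply _ measurableSet_Ioi,
      ← ofReal_integral_eq_lintegral_ofReal hfint.integrableOn
        (Filter.Eventually.of_forall hf_nonneg),
      ENNReal.toReal_ofReal (integral_nonneg hf_nonneg)]
  have hIoi0 : η (Ioi 0) = 1 := by
    have hnoatom : η {0} = 0 := by
      rw [hη_density]
      exact withDensity_absolutelyContinuous _ _ (by simp)
    refine (prob_compl_eq_zero_iff measurableSet_Ioi).1 ?_
    rw [compl_Ioi]
    refine measure_mono_null (t := {u | ¬ 0 ≤ u} ∪ {0}) (fun u hu => ?_)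
      (measure_union_null hη_nonneg hnoatom)
    rcases (show u ≤ 0 from hu).eq_or_lt with h | h
    · exact Or.inr h
    · exact Or.inl (not_le.2 h)
  obtain ⟨a, ha0, ha⟩ : ∃ a : ℝ, 0 < a ∧ 1 - ε / 2 < η.real (Ioi a) := by
    have hlim : Filter.Tendsto (fun n : ℕ => η (Ioi (1 / ((n:ℝ) + 1)))) Filter.atTop
        (nhds (η (⋃ n : ℕ, Ioi (1 / ((n:ℝ) + 1))))) :=
      tendsto_measure_iUnion_atTop fun n k hnk => Ioi_subset_Ioi (by gcongr)
    have hU : (⋃ n : ℕ, Ioi (1 / ((n:ℝ) + 1))) = Ioi 0 := by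
      ext x
      simp only [mem_iUnion, mem_Ioi]
      exact ⟨fun ⟨n, hn⟩ => (by positivity : (0:ℝ) < 1 / ((n:ℝ) + 1)).trans hn,
        fun hx => exists_nat_one_div_lt hx⟩
    rw [hU, hIoi0] at hlim
    have hlim' := (ENNReal.tendsto_toReal ENNReal.one_ne_top).comp hlim
    rw [ENNReal.toReal_one] at hlim'
    obtain ⟨n, hn⟩ := (hlim'.eventually_const_lt (by linarith : 1 - ε / 2 < 1)).exists
    exact ⟨1 / ((n:ℝ) + 1), by positivity, hn⟩
  set s : ℝ := sStar / 2 with hsdef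
  have hs : s ∈ Ico 0 sStar := ⟨by positivity, by rw [hsdef]; linarith⟩
  have hspos : 0 < s := by positivity
  set C : ℝ := shotNoiseBound σ ρ ν (tildeLoss η ℓ s) - tildeLoss η ℓ s τ with hCdef
  -- `M` is a value of `a ℓ(τ) / θ` for which the Chernoff bound at `s` is at most `ε / 2`.
  set M : ℝ := (C - Real.log (ε / 2)) / s + W with hM
  refine ⟨a * ℓ τ / (|M| + W + 1), by positivity, fun θ hθ hθδ => ?_⟩
  have hMθ : |M| + W + 1 ≤ a * ℓ τ / θ := by
    rw [le_div_iff₀ hθ, mul_comm]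
    exact (le_div_iff₀ (by positivity)).1 hθδ
  have hsub : Ioi a ⊆ Ioi (W * θ / ℓ τ) := by
    refine Ioi_subset_Ioi ?_
    rw [div_le_iff₀ hℓτ, ← le_div_iff₀ hθ]
    linarith [abs_nonneg M]
  have hwd := zetaWellDefined (W := W) hη_nonneg hs0 hmgf hℓ hℓτ hθ hf hf_nonneg hη_density hC
  have hpt : ∀ x ∈ Ioi a, f x * (1 - ε / 2) ≤ zetaIntegrand f η ℓ τ W σ ρ ν sStar θ x := by
    intro x hx
    refine mul_le_mul_of_nonneg_left (le_max_of_le_right (sub_le_sub_left ?_ 1)) (hf_nonneg x)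
    rw [← Real.le_log_iff_exp_le (by positivity)]
    refine (ciInf_le (bddBelow_range_chernoffExponent (hwd.bddBelow x (hsub hx))) ⟨s, hs⟩).trans ?_
    have hxa : a * ℓ τ / θ ≤ x * ℓ τ / θ := by
      have := le_of_lt (mem_Ioi.1 hx)
      gcongr
    have hMx : M - W ≤ x * ℓ τ / θ - W := by linarith [le_abs_self M]
    have h1 := mul_le_mul_of_nonneg_left hMx hspos.le
    have h2 : s * (M - W) = C - Real.log (ε / 2) := by
      rw [hM]
      field_simp
      ring
    simp only [chernoffExponent, ← hCdef]
    linarith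
  have h1 : (1 - ε / 2) * (1 - ε / 2) < zeta f η ℓ τ W σ ρ ν sStar θ := by
    calc (1 - ε / 2) * (1 - ε / 2) < η.real (Ioi a) * (1 - ε / 2) :=
          mul_lt_mul_of_pos_right ha (by linarith)
      _ = ∫ x in Ioi a, f x * (1 - ε / 2) := by rw [integral_mul_const, hreal]
      _ ≤ ∫ x in Ioi a, zetaIntegrand f η ℓ τ W σ ρ ν sStar θ x :=
          setIntegral_mono_on (hfint.integrableOn.mul_const _) (hwd.integrable.mono_set hsub)
            measurableSet_Ioi hpt
      _ ≤ zeta f η ℓ τ W σ ρ ν sStar θ :=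
          setIntegral_mono_set hwd.integrable
            (Filter.Eventually.of_forall (zetaIntegrand_nonneg hf_nonneg)) hsub.eventuallyLE
  nlinarith [sq_nonneg ε]

end Zeta

/-! ### The link reliability -/

section Reliability

variable {ℓ : ℝ → ℝ} {τ W θ : ℝ}

/-- The event `SINR > θ` in terms of an enumeration `x` of the transmitters, the dedicated
transmitter `t` and the sequence `u` of fading variables.  The fading from `t` is written as a series
so that the event is visibly measurable in `((x, t), u)`. -/
def successEvent (ℓ : ℝ → ℝ) (τ W θ : ℝ) : Set (((ℕ → Plane) × Plane) × (ℕ → ℝ)) :=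
  {p | ENNReal.ofReal θ * ((∑' n, if p.1.1 n = p.1.2 then 0
      else ENNReal.ofReal (p.2 n * ℓ ‖p.1.1 n‖)) + ENNReal.ofReal W)
    < ∑' n, if p.1.1 n = p.1.2 then ENNReal.ofReal (p.2 n * ℓ τ) else 0}

lemma measurableSet_successEvent (hℓ : IsPathLoss ℓ) :
    MeasurableSet (successEvent ℓ τ W θ) := by
  have hℓm : Measurable fun x : Plane => ℓ ‖x‖ :=
    (hℓ.continuous.comp_continuous continuous_norm fun x => norm_nonneg x).measurable
  have heq : ∀ n, MeasurableSet {p : ((ℕ → Plane) × Plane) × (ℕ → ℝ) | p.1.1 n = p.1.2} :=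
    fun n => measurableSet_eq_fun (by fun_prop) (by fun_prop)
  refine measurableSet_lt (measurable_const.mul ((Measurable.tsum fun n => ?_).add_const _))
    (Measurable.tsum fun n => ?_)
  · refine Measurable.ite (heq n) measurable_const (Measurable.ennreal_ofReal ?_)
    refine Measurable.mul (by fun_prop) (hℓm.comp (by fun_prop))
  · exact Measurable.ite (heq n) (by fun_prop) measurable_const

lemma mem_successEvent_iff {x : ℕ → Plane} (hx : Function.Injective x) (N : ℕ) (u : ℕ → ℝ) :
    ((x, x N), u) ∈ successEvent ℓ τ W θ ↔
      ENNReal.ofReal θ * (weightedTotal (fun n => ℓ ‖x n‖) N u + ENNReal.ofReal W)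
        < ENNReal.ofReal (u N * ℓ τ) := by
  have h : ∑' n, (if n = N then ENNReal.ofReal (u n * ℓ τ) else 0)
      = ENNReal.ofReal (u N * ℓ τ) := by
    rw [tsum_eq_single N fun n hn => if_neg hn, if_pos rfl]
  simp only [successEvent, mem_ofPred_eq, h, hx.eq_iff, weightedTotal]

lemma interference_eq_weightedTotal {x : ℕ → Plane} (hx : Function.Injective x) (N : ℕ)
    (g : Plane → ℝ) : interference ℓ (range x) (x N) g
      = weightedTotal (fun n => ℓ ‖x n‖) N fun n => g (x n) := by
  classical
  rw [interference, tsum_subtype (range x \ {x N}) fun y => ENNReal.ofReal (g y * ℓ ‖y‖),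
    ← hx.tsum_eq, weightedTotal]
  · refine tsum_congr fun n => ?_
    by_cases hn : n = N
    · simp [hn]
    · have hmem : x n ∈ range x \ {x N} := ⟨mem_range_self n, hx.ne hn⟩
      rw [indicator_of_mem hmem, if_neg hn]
  · exact (support_indicator_subset).trans sdiff_subset

lemma lt_sinr_iff_mem_successEvent (hθ : 0 < θ) {x : ℕ → Plane} (hx : Function.Injective x)
    (N : ℕ) (g : Plane → ℝ) : ENNReal.ofReal θ < sinr ℓ τ W (range x) (x N) g ↔
      ((x, x N), fun n => g (x n)) ∈ successEvent ℓ τ W θ := by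
  rw [mem_successEvent_iff hx, sinr, interference_eq_weightedTotal hx,
    ENNReal.lt_div_iff_mul_lt (Or.inr ENNReal.ofReal_ne_top)
      (Or.inr (ENNReal.ofReal_pos.2 hθ).ne')]

end Reliability

end SpatialCalculus

theorem theorem5
    -- the stationary framework
    {Ω : Type*} [MeasurableSpace Ω] [AddAction SpatialCalculus.Plane Ω]
    [MeasurableVAdd₂ SpatialCalculus.Plane Ω]
    (P : Measure Ω) [IsProbabilityMeasure P] [VAddInvariantMeasure SpatialCalculus.Plane Ω P]
    -- transmitters and receivers
    (Φ Ψ : Ω → Set SpatialCalculus.Plane)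
    (hΦ : SpatialCalculus.IsPointProcess Φ) (hΨ : SpatialCalculus.IsPointProcess Ψ)
    (hΦ_flow : SpatialCalculus.IsFlowCompatible Φ) (hΨ_flow : SpatialCalculus.IsFlowCompatible Ψ)
    (h_erg : SpatialCalculus.IsJointlyErgodic P Φ Ψ)
    (h_int_pos : 0 < SpatialCalculus.intensity P Ψ)
    (h_int_fin : SpatialCalculus.intensity P Ψ < ∞)
    -- the bipolar network
    (τ : ℝ) (hτ : 0 < τ)
    (tx : Ω → SpatialCalculus.Plane → SpatialCalculus.Plane)
    (h_bip : SpatialCalculus.IsBipolarNetwork Φ Ψ tx τ)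
    -- path loss and noise
    (ℓ : ℝ → ℝ) (hℓ : SpatialCalculus.IsPathLoss ℓ) (hℓτ : 0 < ℓ τ)
    (W : ℝ) (hW : 0 ≤ W)
    -- the law of the fading and its density
    (η : Measure ℝ) [IsProbabilityMeasure η] (f : ℝ → ℝ) (hf : Measurable f)
    (hf_nonneg : ∀ x, 0 ≤ f x)
    (hη_density : η = volume.withDensity (fun x => ENNReal.ofReal (f x)))
    (hη_nonneg : ∀ᵐ u ∂η, 0 ≤ u) (hη_mean : ∫ u, u ∂η = 1)
    (hη_exp : SpatialCalculus.HasExponentialMoments η)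
    -- the fading from the transmitters to the receiver at the origin
    (h : Ω → SpatialCalculus.Plane → ℝ)
    (h_fading : SpatialCalculus.IsIIDMarking
      (SpatialCalculus.sigmaOf Φ ⊔ MeasurableSpace.comap (fun ω => tx ω 0) inferInstance)
      (SpatialCalculus.palm P Ψ) Φ h η)
    -- ball regulation of the transmitters with respect to the receivers
    (σ ρ ν : ℝ) (hσ : 0 ≤ σ) (hν : 0 ≤ ν)
    (h_reg : SpatialCalculus.IsBallRegulated (SpatialCalculus.palm P Ψ) Φ σ ρ ν) :
    (∀ sStar : ℝ, 0 < sStar → SpatialCalculus.FiniteMgfOn η sStar → ∀ θ : ℝ, 0 < θ →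
      SpatialCalculus.ZetaWellDefined f η ℓ τ W σ ρ ν sStar θ ∧
      ∀ᵐ ω ∂(SpatialCalculus.palm P Ψ),
        SpatialCalculus.zeta f η ℓ τ W σ ρ ν sStar θ ≤
          SpatialCalculus.linkReliability (SpatialCalculus.palm P Ψ) Φ tx h ℓ τ W θ ω) ∧
    (∀ ε : ℝ, 0 < ε → ∃ δ : ℝ, 0 < δ ∧ ∀ θ : ℝ, 0 < θ → θ ≤ δ →
      ∀ᵐ ω ∂(SpatialCalculus.palm P Ψ),
        1 - ε < SpatialCalculus.linkReliability (SpatialCalculus.palm P Ψ) Φ tx h ℓ τ W θ ω) := by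
  have hQ := SpatialCalculus.isProbabilityMeasure_palm hΨ h_int_pos h_int_fin
  set Q := SpatialCalculus.palm P Ψ with hQdef
  obtain ⟨X, hXm, hXrange, hHm, hHlaw, hHind, hHindep⟩ := h_fading
  have hΦle : SpatialCalculus.sigmaOf Φ ≤ ‹MeasurableSpace Ω› := hΦ.measurable.comap_le
  have h𝒢 : SpatialCalculus.sigmaOf Φ ⊔ MeasurableSpace.comap (fun ω => tx ω 0) inferInstance
      ≤ ‹MeasurableSpace Ω› := sup_le hΦle h_bip.measurable.comap_le
  -- Almost surely, the configuration is regulated, `X` enumerates it, and the dedicated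
  -- transmitter of the receiver at the origin is one of its points, at distance `τ`.
  have hgood : ∀ᵐ ω ∂Q, (∀ r : ℝ, 0 ≤ r →
        ((Φ ω ∩ Metric.ball 0 r).ncard : ℝ) ≤ σ + ρ * r + ν * r ^ 2) ∧
      Function.Injective (fun n => X n ω) ∧ Set.range (fun n => X n ω) = Φ ω ∧
      tx ω 0 ∈ Φ ω ∧ ‖tx ω 0‖ = τ := by
    filter_upwards [SpatialCalculus.IsBallRegulated.ae_forall hΦ h_reg, hXrange,
      SpatialCalculus.zero_mem_ae_palm hΨ hΨ_flow] with ω h1 h2 h3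
    refine ⟨h1, h2.1, h2.2, (h_bip.bijOn ω).mapsTo h3, ?_⟩
    have h4 := h_bip.dist_eq ω 0 h3
    rwa [dist_zero_right] at h4
  have hC : ∀ sStar : ℝ, 0 < sStar → SpatialCalculus.FiniteMgfOn η sStar →
      ∀ s ∈ Ico 0 sStar, 0 ≤ SpatialCalculus.shotNoiseBound σ ρ ν
        (SpatialCalculus.tildeLoss η ℓ s) - SpatialCalculus.tildeLoss η ℓ s τ := by
    intro sStar hs0 hmgf s hs
    obtain ⟨ω, hreg, -, -, ht, htτ⟩ := hgood.exists
    have h := SpatialCalculus.sum_tildeLoss_le hη_nonneg hs0 hmgf hℓ hs (hΦ.locallyFinite ω)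
      hreg ht ∅ (by simp)
    rwa [Finset.sum_empty, htτ] at h
  have hbound : ∀ sStar : ℝ, 0 < sStar → SpatialCalculus.FiniteMgfOn η sStar → ∀ θ : ℝ, 0 < θ →
      SpatialCalculus.ZetaWellDefined f η ℓ τ W σ ρ ν sStar θ ∧
      ∀ᵐ ω ∂Q, SpatialCalculus.zeta f η ℓ τ W σ ρ ν sStar θ ≤
        SpatialCalculus.linkReliability Q Φ tx h ℓ τ W θ ω := by
    intro sStar hs0 hmgf θ hθ
    have hwd : SpatialCalculus.ZetaWellDefined f η ℓ τ W σ ρ ν sStar θ :=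
      SpatialCalculus.zetaWellDefined hη_nonneg hs0 hmgf hℓ hℓτ hθ hf hf_nonneg hη_density
        (hC sStar hs0 hmgf)
    refine ⟨hwd, ?_⟩
    have hYm : Measurable[SpatialCalculus.sigmaOf Φ ⊔
        MeasurableSpace.comap (fun ω => tx ω 0) inferInstance] fun ω => ((fun n => X n ω), tx ω 0) :=
      (@measurable_pi_lambda _ _ _ (_) _ _ hXm).prodMk
        (Measurable.mono (comap_measurable fun ω => tx ω 0) le_sup_right le_rfl)
    have hHm' : Measurable fun ω n => h ω (X n ω) := measurable_pi_lambda _ hHm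
    have hEm := SpatialCalculus.measurableSet_successEvent (τ := τ) (W := W) (θ := θ) hℓ
    refine SpatialCalculus.le_condExp_of_indep le_sup_left h𝒢 hYm hHm' hHindep hEm
      (SpatialCalculus.zeta_nonneg hf_nonneg) ?_ ?_
    · filter_upwards [hgood] with ω ⟨hreg, hinj, hrange, ht, htτ⟩
      obtain ⟨N, hN⟩ : tx ω 0 ∈ Set.range fun n => X n ω := hrange ▸ ht
      rw [Measure.map_apply hHm' (measurable_prodMk_left hEm)]
      refine (SpatialCalculus.ofReal_zeta_le_measure (a := fun n => ℓ ‖X n ω‖) (N := N) hHm hHlaw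
        hHind hη_nonneg (fun n => hℓ.nonneg _ (norm_nonneg _)) hf hf_nonneg hη_density hℓτ hW hθ
        hs0 (fun s hs n => hmgf _ (hℓ.mul_mem_Ico hs (norm_nonneg _))) (fun s hs F hF => ?_)
        hwd.integrable).trans (measure_mono fun ω' hω' => ?_)
      · have hle := SpatialCalculus.sum_tildeLoss_le hη_nonneg hs0 hmgf hℓ hs
          (hΦ.locallyFinite ω) hreg ht (F.map ⟨fun n => X n ω, hinj⟩) (by
            intro y hy
            obtain ⟨n, hn, rfl⟩ := Finset.mem_map.1 (Finset.mem_coe.1 hy)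
            refine ⟨hrange ▸ Set.mem_range_self n, fun hnt => hF ?_⟩
            exact hinj (hnt.trans hN.symm) ▸ hn)
        rw [Finset.sum_map, htτ] at hle
        simpa only [SpatialCalculus.tildeLoss_eq_log_mgf, Function.Embedding.coeFn_mk] using hle
      · have := (SpatialCalculus.mem_successEvent_iff hinj N fun n => h ω' (X n ω')).2 hω'
        simp only [hN] at this
        exact this
    · filter_upwards [hgood] with ω ⟨_, hinj, hrange, ht, _⟩
      obtain ⟨N, hN⟩ : tx ω 0 ∈ Set.range fun n => X n ω := hrange ▸ ht
      have := SpatialCalculus.lt_sinr_iff_mem_successEvent (ℓ := ℓ) (τ := τ) (W := W) hθ hinj N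
        (h ω)
      simp only [hN, hrange] at this
      exact propext this
  refine ⟨hbound, fun ε hε => ?_⟩
  obtain ⟨sStar, hs0, hmgf⟩ := hη_exp
  obtain ⟨δ, hδ, hζ⟩ := SpatialCalculus.exists_forall_lt_zeta (W := W) hη_nonneg hs0 hmgf hℓ hℓτ
    hW hf hf_nonneg hη_density (hC sStar hs0 hmgf) hε
  refine ⟨δ, hδ, fun θ hθ hθδ => ?_⟩
  filter_upwards [(hbound sStar hs0 hmgf θ hθ).2] with ω hω
  exact (hζ θ hθ hθδ).trans_le hω
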